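/- **Setting.** For $T>1$ put $q=1-1/T$. On $\ell^2(\mathbb{Z})$ let $\alpha_k$ be the operator with matrix elements $[\alpha_k]_{i,j}=1$ if $i-j=k$ and $0$ otherwise. The one-particle transfer matrix from time $t$ to time $t+1$ is $e^{\gamma_t}$, where $$\gamma_t=\sum_{k\ge1}\frac{q^{k|t+1/2|}}{k}\,\alpha_{k}\quad(t\le -1),\qquad \gamma_t=\sum_{k\ge1}\frac{q^{k|t+1/2|}}{k}\,\alpha_{-k}\quad(t\ge 0).$$ Set $G_\uparrow=\sum_{t\le -1}\gamma_t$, $G_\downarrow=\sum_{t\ge0}\gamma_t$, and $G(0,t)=\sum_{u=0}^{t-1}\gamma_u$ for $t\ge0$, $G(0,t)=-\sum_{u=t}^{-1}\gamma_u$ for $t<0$. The two-point functions of the associated Fermi field, with the sites $l\le0$ filled and the sites $l>0$ empty at $t=\pm\infty$, are $$\langle a^*_j(t)a_{j'}(t')\rangle_T=\sum_{l\le0}\big[e^{G_\uparrow-G_\downarrow+G(0,t')}\big]_{j',l}\big[e^{-G_\uparrow+G_\downarrow-G(0,t)}\big]_{l,j},$$ $$\langle a_j(t)a^*_{j'}(t')\rangle_T=\sum_{l>0}\big[e^{G_\uparrow-G_\downarrow+G(0,t)}\big]_{j,l}\big[e^{-G_\uparrow+G_\downarrow-G(0,t')}\big]_{l,j'},$$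 and the Green's function is $R_T(j,t;j',t')=\langle a^*_j(t)a_{j'}(t')\rangle_T$ for $t\ge t'$ and $R_T(j,t;j',t')=-\langle a_{j'}(t')a^*_j(t)\rangle_T$ for $t<t'$. Fix $\tau_0>0$, let $b_\infty(\tau)=-2\ln(1-e^{-\tau/2})$ and $\kappa=\sqrt[3]{2b_\infty''(\tau_0)}$. With $[\,\cdot\,]$ the integer part put $$t(s)=[\tau_0T+sT^{2/3}],\qquad j(r,s)=\big[b_\infty(\tau_0)T+b_\infty'(\tau_0)sT^{2/3}+\tfrac12 b_\infty''(\tau_0)s^2T^{1/3}+rT^{1/3}\big],$$ $$g(r,s)=-\tfrac12\,j(r,s)\,t(s)\,\ln(1-1/T),$$ $$K_T(r,s;r',s')=e^{g(r,s)-g(r',s')}\,T^{1/3}\,R_T\big(j(r,s),t(s);j(r',s'),t(s')\big).$$ Let $\mathrm{Ai}$ be the Airy function and $$K^{\mathrm{Airy}}(r,s;r',s')=\begin{cases}\displaystyle\int_{-\infty}^0 e^{\lambda(s-s')}\,\mathrm{Ai}(r-\lambda)\,\mathrm{Ai}(r'-\lambda)\,d\lambda & (s\ge s'),\\[2mm]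 \displaystyle-\int_0^{\infty} e^{\lambda(s-s')}\,\mathrm{Ai}(r-\lambda)\,\mathrm{Ai}(r'-\lambda)\,d\lambda & (s<s').\end{cases}$$ **Proposition 4.2.** For every $\tau_0>0$, $$\lim_{T\to\infty}K_T(r,s;r',s')=\kappa^{-1}K^{\mathrm{Airy}}\Big(\frac r\kappa,\frac\kappa2 s;\frac{r'}\kappa,\frac\kappa2 s'\Big)\qquad\text{for all } r,s,r',s'\in\mathbb{R}.$$ For every bounded set $B\subset\mathbb{R}^4$ and every $\delta>0$ the convergence is uniform over the points $(r,s,r',s')\in B$ with $s\ge s'$ or $s'-s\ge\delta$. -/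

import Mathlib

open Filter Topology MeasureTheory Set

namespace CrystalEdge

noncomputable section

/-! ### One-particle operators on the lattice -/

/-- The one-particle space `ℓ²(ℤ)`. -/
abbrev OneParticle : Type := lp (fun _ : ℤ => ℂ) 2

/-- Bounded operators on the one-particle space. -/
abbrev Op : Type := OneParticle →L[ℂ] OneParticle

theorem memlp_shift (k : ℤ) (f : OneParticle) :
    Memℓp (fun i : ℤ => (f : ℤ → ℂ) (i - k)) 2 := by
  have h2 : (0 : ℝ) < (2 : ENNReal).toReal := by norm_num
  refine memℓp_gen ?_
  have h := (memℓp_gen_iff h2).1 (lp.memℓp f)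
  exact (Equiv.subRight k).summable_iff.2 h

theorem norm_shift (k : ℤ) (f : OneParticle) :
    ‖(⟨fun i : ℤ => (f : ℤ → ℂ) (i - k), memlp_shift k f⟩ : OneParticle)‖ = ‖f‖ := by
  have h2 : (0 : ℝ) < (2 : ENNReal).toReal := by norm_num
  rw [lp.norm_eq_tsum_rpow h2, lp.norm_eq_tsum_rpow h2]
  congr 1
  exact (Equiv.subRight k).tsum_eq (fun i => ‖(f : ℤ → ℂ) i‖ ^ (2 : ENNReal).toReal)

/-- The shift `α_k`, i.e. the operator with matrix elements `[α_k]_{i,j} = 1` if `i - j = k` and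
`0` otherwise: `(α_k f)(i) = f(i - k)`. -/
def shift (k : ℤ) : Op :=
  LinearMap.mkContinuous
    { toFun := fun f => ⟨fun i : ℤ => (f : ℤ → ℂ) (i - k), memlp_shift k f⟩
      map_add' := fun _ _ => rfl
      map_smul' := fun _ _ => rfl }
    1 (fun f => by rw [one_mul]; exact (norm_shift k f).le)

/-- The matrix element `[A]_{i,j}` of an operator in the canonical basis of `ℓ²(ℤ)`. -/
def entry (A : Op) (i j : ℤ) : ℂ :=
  ((A (lp.single 2 j (1 : ℂ)) : OneParticle) : ℤ → ℂ) i

/-- The shift has the matrix elements it should have. -/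
theorem entry_shift (k i j : ℤ) : entry (shift k) i j = if i - j = k then 1 else 0 := by
  change ((lp.single 2 j (1 : ℂ) : OneParticle) : ℤ → ℂ) (i - k) = _
  rw [lp.single_apply]
  by_cases h : i - j = k
  · have h' : i - k = j := by omega
    subst h'
    simp [h]
  · have h' : ¬ (i - k = j) := by omega
    rw [if_neg h]
    simp [Pi.single, Function.update, h']

/-! ### Transfer matrices and their generators -/

/-- The generator of the one-particle transfer matrix from time `t` to time `t + 1`,
`∑_{k ≥ 1} (q ^ (k |t + 1/2|) / k) α_{±k}`, with the sign `+` (up-steps) for `t ≤ -1` and the sign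
`-` (down-steps) for `t ≥ 0`. -/
def stepGen (q : ℝ) (t : ℤ) : Op :=
  ∑' n : ℕ, (((q ^ (((n : ℝ) + 1) * |(t : ℝ) + 1 / 2|) / ((n : ℝ) + 1) : ℝ)) : ℂ) •
    shift (if t < 0 then (n : ℤ) + 1 else -((n : ℤ) + 1))

/-- `G_↑(0)`: the sum of all generators over negative times. -/
def upGen (q : ℝ) : Op := ∑' n : ℕ, stepGen q (-1 - (n : ℤ))

/-- `G_↓(0)`: the sum of all generators over nonnegative times. -/
def downGen (q : ℝ) : Op := ∑' n : ℕ, stepGen q (n : ℤ)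

/-- The generator `G(0,t)` of the propagator from time `0` to time `t`. The transfer matrices
commute, so that for `t ≥ 0` it is the sum of the generators over the times `0, …, t - 1`; for
`t < 0` it is `-G(t,0)`. -/
def propGen (q : ℝ) (t : ℤ) : Op :=
  if 0 ≤ t then ∑ u ∈ Finset.Ico 0 t, stepGen q u else -∑ u ∈ Finset.Ico t 0, stepGen q u

/-- `exp (G_↑(0) - G_↓(0) + G(0,t))`. -/
def waveOp (q : ℝ) (t : ℤ) : Op :=
  NormedSpace.exp (upGen q - downGen q + propGen q t)

/-- `exp (-G_↑(0) + G_↓(0) - G(0,t))`. -/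
def waveOpInv (q : ℝ) (t : ℤ) : Op :=
  NormedSpace.exp (-upGen q + downGen q - propGen q t)

/-! ### The fermionic Green's function -/

/-- The two-point function `⟨a*_j(t) a_{j'}(t')⟩`, a sum over the filled sites `l ≤ 0`. -/
def creAnn (q : ℝ) (j t j' t' : ℤ) : ℂ :=
  ∑' l : {l : ℤ // l ≤ 0}, entry (waveOp q t') j' l * entry (waveOpInv q t) l j

/-- The two-point function `⟨a_j(t) a*_{j'}(t')⟩`, a sum over the empty sites `l > 0`. -/
def annCre (q : ℝ) (j t j' t' : ℤ) : ℂ :=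
  ∑' l : {l : ℤ // 0 < l}, entry (waveOp q t) j l * entry (waveOpInv q t') l j'

/-- The Green's function `R_T(j,t;j',t')`, with `q = 1 - 1/T`:
`⟨a*_j(t) a_{j'}(t')⟩` for `t ≥ t'` and `-⟨a_{j'}(t') a*_j(t)⟩` for `t < t'`. -/
def green (T : ℝ) (j t j' t' : ℤ) : ℂ :=
  if t' ≤ t then creAnn (1 - 1 / T) j t j' t' else -annCre (1 - 1 / T) j' t' j t

/-! ### Edge scaling -/

/-- The macroscopic border `b_∞(τ) = -2 ln (1 - e^{-τ/2})`, `τ > 0`. -/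
def border (τ : ℝ) : ℝ := -2 * Real.log (1 - Real.exp (-τ / 2))

/-- The time `t(s)`. -/
def edgeTime (τ₀ T s : ℝ) : ℤ := ⌊τ₀ * T + s * T ^ (2 / 3 : ℝ)⌋

/-- The position `j(r,s)`. -/
def edgePos (τ₀ T r s : ℝ) : ℤ :=
  ⌊border τ₀ * T + deriv border τ₀ * s * T ^ (2 / 3 : ℝ)
    + 1 / 2 * deriv (deriv border) τ₀ * s ^ 2 * T ^ (1 / 3 : ℝ) + r * T ^ (1 / 3 : ℝ)⌋

/-- The exponent of the conjugation, `g(r,s) = -j(r,s) t(s) ln (1 - 1/T) / 2`. -/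
def conjExp (τ₀ T r s : ℝ) : ℝ :=
  -((edgePos τ₀ T r s : ℝ) * (edgeTime τ₀ T s : ℝ) * Real.log (1 - 1 / T) / 2)

/-- The edge-scaled and conjugated kernel `K_T(r,s;r',s')`. -/
def edgeKernel (τ₀ T r s r' s' : ℝ) : ℂ :=
  ((Real.exp (conjExp τ₀ T r s - conjExp τ₀ T r' s') * T ^ (1 / 3 : ℝ) : ℝ) : ℂ) *
    green T (edgePos τ₀ T r s) (edgeTime τ₀ T s) (edgePos τ₀ T r' s') (edgeTime τ₀ T s')

/-- The scale `κ = (2 b_∞''(τ₀))^{1/3}`. -/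
def kappa (τ₀ : ℝ) : ℝ := (2 * deriv (deriv border) τ₀) ^ (1 / 3 : ℝ)

/-! ### The Airy kernel -/

/-- The integral of `exp (z ^ 3 / 3 - x z)` along the ray from `0` to `∞` in the direction `w`. -/
def airyRay (w : ℂ) (x : ℝ) : ℂ :=
  ∫ p in Ioi (0 : ℝ), Complex.exp (((p : ℂ) * w) ^ 3 / 3 - (x : ℂ) * ((p : ℂ) * w)) * w

/-- The Airy function `Ai(x) = (1 / 2πi) ∫ exp (z ^ 3 / 3 - x z) dz`, the (absolutely convergent)
integral being along the contour that comes from infinity to `0` along the ray of argument `-π/3`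
and returns to infinity along the ray of argument `π/3`. It is real for real `x`. -/
def Ai (x : ℝ) : ℝ :=
  ((airyRay (Complex.exp ((Real.pi / 3 : ℝ) * Complex.I)) x
      - airyRay (Complex.exp ((-(Real.pi / 3) : ℝ) * Complex.I)) x)
    / (2 * (Real.pi : ℂ) * Complex.I)).re

/-- The (extended) Airy kernel `K^Airy(r,s;r',s')`. -/
def airyKernel (r s r' s' : ℝ) : ℝ :=
  if s' ≤ s then
    ∫ x in Iic (0 : ℝ), Real.exp (x * (s - s')) * Ai (r - x) * Ai (r' - x)
  else
    -∫ x in Ioi (0 : ℝ), Real.exp (x * (s - s')) * Ai (r - x) * Ai (r' - x)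

end

end CrystalEdge

open Filter Topology MeasureTheory Set

namespace CrystalEdge

noncomputable section

/-! ### Matrix elements of exponentials of Laurent operators -/

/-! All generators are series of shifts, so the propagators are Laurent operators: their matrix
elements are Fourier coefficients of the exponential of a symbol, on any circle where the defining
series converges. Write q = e^{-η}, u = ηt. On the circle of radius e^{-u/2+σ} the up and down
coefficients balance, and the symbol is the odd function S = `action` at w = σ + iθ. Oddness makes
the inverse operator produce the same function `wave` as the operator itself (`entry_waveOp`,
`entry_waveOpInv`). The two-point functions thus become sums over lattice sites of products of two
wave functions with a factor exponential in the time difference; the prefactor depending on j, j' is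
exactly what the conjugation g removes (`edgeKernel_eq_of_le`, `edgeKernel_eq_of_lt`).

The wave function at x is the integral of exp(S(w) - xw). Since S is odd it has no quadratic term,
so w = 0 is a degenerate saddle when x = S'(0) = `edgeSlope`. With N = T^{1/3} the Fourier weights
are of order N³, whence S(v/N) - S'(0)v/N tends to c v³/3 (`EdgeRegime.tendsto_action`). The decay
of Re S along vertical lines gives a Gaussian majorant (`EdgeRegime.integrand_bound`), and N times
the wave function tends to a cubic exponential integral, which contour deformation identifies as κ⁻¹
Ai(ξ/κ) with κ³ = c = 2 b_∞''(τ₀) (`cubicLine_eq_Ai`). The slope is b_∞(u)/η up to a bounded error,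
so a second-order Taylor expansion of b_∞ places j(r,s) at distance rN + o(N) from it
(`tendsto_edgePos`).

The kernel is then a Riemann sum of mesh 1/N (`tendsto_riemann_sum`). The contour of abscissa σ/N
bounds the wave functions by a multiple of e^{-σm/N} at displacement m. For s ≥ s' the sum runs to
the right, where this decays, so no time gap is needed. For s < s' it runs to the left, where the
bound grows, and the time factor must beat it; this is why s' - s has to stay away from 0. Limits
are taken along arbitrary convergent parameters, which on compact sets yields uniform convergence.
-/

theorem shift_apply (k : ℤ) (f : OneParticle) (i : ℤ) : (shift k f : ℤ → ℂ) i = (f : ℤ → ℂ) (i - k) :=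
  rfl

theorem norm_shift_le (k : ℤ) : ‖shift k‖ ≤ 1 :=
  LinearMap.mkContinuous_norm_le _ zero_le_one _

theorem shift_single (k j : ℤ) :
    shift k (lp.single 2 j (1 : ℂ)) = lp.single 2 (j + k) (1 : ℂ) := by
  ext i
  rw [shift_apply, lp.single_apply, lp.single_apply]
  by_cases h : i = j + k
  · subst h; simp
  · have h' : ¬ (i - k = j) := by omega
    simp [Pi.single, Function.update, h, h']

/-- A matrix element as a continuous linear functional. -/
def entryCLM (i j : ℤ) : Op →L[ℂ] ℂ :=
  (lp.evalCLM ℂ (fun _ : ℤ => ℂ) 2 i).comp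
    (ContinuousLinearMap.apply ℂ OneParticle (lp.single 2 j (1 : ℂ) : OneParticle))

theorem entryCLM_apply (i j : ℤ) (A : Op) : entryCLM i j A = entry A i j := rfl

theorem entry_mul_shift (A : Op) (k i j : ℤ) : entry (A * shift k) i j = entry A i (j + k) := by
  unfold entry
  rw [mul_apply_eq_comp, shift_single]

/-- The `n`-th Fourier coefficient of a function on `[-π, π]`. -/
def coef (φ : ℝ → ℂ) (n : ℤ) : ℂ :=
  (2 * (Real.pi : ℂ))⁻¹ *
    ∫ θ in (-Real.pi)..Real.pi, φ θ * Complex.exp (-((n : ℂ) * θ * Complex.I))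

/-- The character `θ ↦ exp (i k θ)`. -/
def character (k : ℤ) (θ : ℝ) : ℂ := Complex.exp ((k : ℂ) * θ * Complex.I)

theorem continuous_character (k : ℤ) : Continuous (character k) := by
  unfold character; fun_prop

theorem norm_character (k : ℤ) (θ : ℝ) : ‖character k θ‖ = 1 := by
  unfold character
  have : (k : ℂ) * θ * Complex.I = ((k * θ : ℝ) : ℂ) * Complex.I := by push_cast; ring
  rw [this, Complex.norm_exp_ofReal_mul_I]

theorem coef_mul_character (φ : ℝ → ℂ) (k n : ℤ) :
    coef (fun θ => φ θ * character k θ) n = coef φ (n - k) := by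
  unfold coef character
  congr 1
  refine intervalIntegral.integral_congr fun θ _ => ?_
  simp only [mul_assoc]
  rw [← Complex.exp_add]
  congr 2
  push_cast; ring

theorem coef_one (n : ℤ) : coef (fun _ => 1) n = if n = 0 then 1 else 0 := by
  have hpi : (Real.pi : ℂ) ≠ 0 := by exact_mod_cast Real.pi_ne_zero
  unfold coef
  split_ifs with h
  · subst h
    simp
    rw [← two_mul]
    field_simp
  · have hn : -((n : ℂ) * Complex.I) ≠ 0 := by
      simp [h, Complex.I_ne_zero]
    have := integral_exp_mul_complex (a := -Real.pi) (b := Real.pi) hn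
    simp only [one_mul]
    have e : ∀ θ : ℝ, -((n : ℂ) * θ * Complex.I) = -((n : ℂ) * Complex.I) * θ := fun θ => by ring
    simp only [e]
    rw [this]
    have e2 : Complex.exp (-((n : ℂ) * Complex.I) * (Real.pi : ℝ)) =
        Complex.exp (-((n : ℂ) * Complex.I) * ((-Real.pi : ℝ) : ℂ)) := by
      rw [Complex.exp_eq_exp_iff_exists_int]
      refine ⟨-n, ?_⟩
      push_cast; ring
    rw [e2]; simp

/-- `φ` describes `A` on the circle of radius `ρ`. -/
def IsLaurent (ρ : ℝ) (A : Op) (φ : ℝ → ℂ) : Prop :=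
  Continuous φ ∧ ∀ i j : ℤ, ((ρ ^ (i - j) : ℝ) : ℂ) * entry A i j = coef φ (i - j)

/-- Multiplication by `G` on the right multiplies the function describing an operator on the
circle of radius `ρ` by `g`. -/
def HasSymbol (ρ : ℝ) (G : Op) (g : ℝ → ℂ) : Prop :=
  Continuous g ∧ ∀ A φ, IsLaurent ρ A φ → IsLaurent ρ (A * G) (fun θ => φ θ * g θ)

theorem isLaurent_one (ρ : ℝ) : IsLaurent ρ 1 (fun _ => 1) := by
  refine ⟨continuous_const, fun i j => ?_⟩
  have h1 : entry (1 : Op) i j = if i - j = 0 then 1 else 0 := by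
    have : (1 : Op) = shift 0 := by
      ext f i
      rw [shift_apply, sub_zero]; rfl
    rw [this, entry_shift]
  rw [h1, coef_one]
  split_ifs with h
  · simp [h]
  · simp

theorem coef_sub {φ ψ : ℝ → ℂ} (hφ : Continuous φ) (hψ : Continuous ψ) (n : ℤ) :
    coef (fun θ => φ θ - ψ θ) n = coef φ n - coef ψ n := by
  unfold coef
  rw [← mul_sub, ← intervalIntegral.integral_sub]
  · simp only [sub_mul]
  all_goals
    apply Continuous.intervalIntegrable; fun_prop

theorem IsLaurent.sub {ρ : ℝ} {A B : Op} {φ ψ : ℝ → ℂ} (hA : IsLaurent ρ A φ)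
    (hB : IsLaurent ρ B ψ) : IsLaurent ρ (A - B) (fun θ => φ θ - ψ θ) := by
  refine ⟨hA.1.sub hB.1, fun i j => ?_⟩
  rw [coef_sub hA.1 hB.1, ← hA.2, ← hB.2, ← mul_sub, ← entryCLM_apply, map_sub]; rfl

theorem HasSymbol.sub {ρ : ℝ} {G K : Op} {g k : ℝ → ℂ} (hG : HasSymbol ρ G g)
    (hK : HasSymbol ρ K k) : HasSymbol ρ (G - K) (fun θ => g θ - k θ) := by
  refine ⟨hG.1.sub hK.1, fun A φ hA => ?_⟩
  have := (hG.2 A φ hA).sub (hK.2 A φ hA)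
  simpa only [mul_sub] using this

theorem IsLaurent.smul {ρ : ℝ} {A : Op} {φ : ℝ → ℂ} (c : ℂ) (hA : IsLaurent ρ A φ) :
    IsLaurent ρ (c • A) (fun θ => c * φ θ) := by
  refine ⟨continuous_const.mul hA.1, fun i j => ?_⟩
  have : coef (fun θ => c * φ θ) (i - j) = c * coef φ (i - j) := by
    unfold coef
    simp only [mul_assoc]
    rw [intervalIntegral.integral_const_mul]
    ring
  rw [this, ← hA.2, ← entryCLM_apply, map_smul, smul_eq_mul, entryCLM_apply]
  ring

theorem HasSymbol.neg {ρ : ℝ} {G : Op} {g : ℝ → ℂ} (hG : HasSymbol ρ G g) :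
    HasSymbol ρ (-G) (fun θ => -g θ) := by
  refine ⟨hG.1.neg, fun A φ hA => ?_⟩
  simpa using (hG.2 A φ hA).smul (-1)

theorem HasSymbol.pow {ρ : ℝ} {G : Op} {g : ℝ → ℂ} (hG : HasSymbol ρ G g) (n : ℕ) :
    IsLaurent ρ (G ^ n) (fun θ => g θ ^ n) := by
  induction n with
  | zero => simpa using isLaurent_one ρ
  | succ n ih => simpa only [pow_succ] using hG.2 _ _ ih

/-- Termwise integration of a series of functions against a character. -/
theorem hasSum_coef {ι : Type*} [Countable ι] {f : ι → ℝ → ℂ} {F : ℝ → ℂ} {b : ι → ℝ}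
    (hf : ∀ i, Continuous (f i)) (hb : Summable b)
    (hfb : ∀ i, ∀ θ ∈ Set.Icc (-Real.pi) Real.pi, ‖f i θ‖ ≤ b i)
    (hF : ∀ θ, HasSum (fun i => f i θ) (F θ)) (n : ℤ) :
    HasSum (fun i => coef (f i) n) (coef F n) := by
  refine HasSum.mul_left _ ?_
  have hpi : -Real.pi ≤ Real.pi := by linarith [Real.pi_pos]
  refine intervalIntegral.hasSum_integral_of_dominated_convergence (fun i _ => b i)
    (fun i => ?_) (fun i => ?_) ?_ ?_ ?_
  · exact (Continuous.aestronglyMeasurable (by have := hf i; fun_prop))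
  · refine Eventually.of_forall fun θ hθ => ?_
    rw [uIoc_of_le hpi] at hθ
    have : ‖Complex.exp (-((n : ℂ) * θ * Complex.I))‖ = 1 := by
      have e : -((n : ℂ) * θ * Complex.I) = ((-(n * θ) : ℝ) : ℂ) * Complex.I := by
        push_cast; ring
      rw [e, Complex.norm_exp_ofReal_mul_I]
    rw [norm_mul, this, mul_one]
    exact hfb i θ ⟨hθ.1.le, hθ.2⟩
  · exact Eventually.of_forall fun θ _ => hb
  · exact intervalIntegrable_const
  · exact Eventually.of_forall fun θ _ => (hF θ).mul_right _

/-- The exponential series is summed on both sides: powers of G are described by powers of g, by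
repeated right multiplication starting from the identity. The symbol is bounded on the period, which
justifies termwise integration. -/
theorem HasSymbol.exp {ρ : ℝ} {G : Op} {g : ℝ → ℂ} (hG : HasSymbol ρ G g) :
    IsLaurent ρ (NormedSpace.exp G) (fun θ => Complex.exp (g θ)) := by
  refine ⟨Complex.continuous_exp.comp hG.1, fun i j => ?_⟩
  obtain ⟨M, hM⟩ := (isCompact_Icc (a := -Real.pi) (b := Real.pi)).exists_bound_of_continuousOn
    hG.1.continuousOn
  have h1 : HasSum (fun n : ℕ => ((ρ ^ (i - j) : ℝ) : ℂ) * entryCLM i j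
      ((n.factorial : ℂ)⁻¹ • G ^ n)) (((ρ ^ (i - j) : ℝ) : ℂ) * entry (NormedSpace.exp G) i j) :=
    ((NormedSpace.exp_series_hasSum_exp' (𝕂 := ℂ) G).mapL (entryCLM i j)).mul_left _
  have h2 : HasSum (fun n : ℕ => coef (fun θ => (n.factorial : ℂ)⁻¹ * g θ ^ n) (i - j))
      (coef (fun θ => Complex.exp (g θ)) (i - j)) := by
    refine hasSum_coef (b := fun n => (n.factorial : ℝ)⁻¹ * M ^ n) (fun n => ?_) ?_ ?_ ?_ _
    · have := hG.1; fun_prop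
    · simpa [div_eq_inv_mul] using Real.summable_pow_div_factorial M
    · intro n θ hθ
      rw [norm_mul, norm_pow, norm_inv, Complex.norm_natCast]
      gcongr
      exact hM θ hθ
    · intro θ
      have := NormedSpace.exp_series_hasSum_exp' (𝕂 := ℂ) (g θ)
      rw [Complex.exp_eq_exp_ℂ]
      simpa using this
  refine h1.unique ?_
  convert h2 using 2 with n
  exact ((hG.pow n).smul _).2 i j

/-- The symbol of an absolutely convergent series of shifts. -/
theorem hasSymbol_of_hasSum {ρ : ℝ} (hρ : 0 < ρ) {c : ℕ → ℝ} {k : ℕ → ℤ} {G : Op}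
    (hG : HasSum (fun n => ((c n : ℝ) : ℂ) • shift (k n)) G)
    (hc : Summable fun n => |c n| * ρ ^ k n) :
    HasSymbol ρ G (fun θ => ∑' n, ((c n * ρ ^ k n : ℝ) : ℂ) * character (k n) θ) := by
  have hnorm : ∀ n θ, ‖((c n * ρ ^ k n : ℝ) : ℂ) * character (k n) θ‖ = |c n| * ρ ^ k n := by
    intro n θ
    rw [norm_mul, norm_character, mul_one, Complex.norm_real, Real.norm_eq_abs, abs_mul,
      abs_of_pos (zpow_pos hρ _)]
  have hcont : Continuous fun θ => ∑' n, ((c n * ρ ^ k n : ℝ) : ℂ) * character (k n) θ := by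
    refine continuous_tsum (fun n => ?_) hc (fun n θ => (hnorm n θ).le)
    exact continuous_const.mul (continuous_character _)
  refine ⟨hcont, fun A φ hA => ⟨hA.1.mul hcont, fun i j => ?_⟩⟩
  obtain ⟨M, hM⟩ := (isCompact_Icc (a := -Real.pi) (b := Real.pi)).exists_bound_of_continuousOn
    hA.1.continuousOn
  have h1 : HasSum (fun n => ((ρ ^ (i - j) : ℝ) : ℂ) *
      entryCLM i j (A * (((c n : ℝ) : ℂ) • shift (k n))))
      (((ρ ^ (i - j) : ℝ) : ℂ) * entryCLM i j (A * G)) :=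
    ((hG.mul_left A).mapL (entryCLM i j)).mul_left _
  have h2 : HasSum (fun n => coef
      (fun θ => φ θ * (((c n * ρ ^ k n : ℝ) : ℂ) * character (k n) θ)) (i - j))
      (coef (fun θ => φ θ * ∑' n, ((c n * ρ ^ k n : ℝ) : ℂ) * character (k n) θ) (i - j)) := by
    refine hasSum_coef (b := fun n => M * (|c n| * ρ ^ k n)) (fun n => ?_) (hc.mul_left M) ?_ ?_ _
    · exact hA.1.mul (continuous_const.mul (continuous_character _))
    · intro n θ hθ
      rw [norm_mul, hnorm]
      exact mul_le_mul_of_nonneg_right (hM θ hθ) (by positivity)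
    · intro θ
      refine HasSum.mul_left _ (Summable.hasSum ?_)
      exact Summable.of_norm (by simpa only [hnorm] using hc)
  refine h1.unique ?_
  convert h2 using 2 with n
  have e : (fun θ => φ θ * (((c n * ρ ^ k n : ℝ) : ℂ) * character (k n) θ)) =
      fun θ => (((c n * ρ ^ k n : ℝ) : ℂ) * φ θ) * character (k n) θ := by
    funext θ; ring
  -- Right multiplication by a shift moves the column index by k, hence i - j to i - j - k;
  -- multiplying by a character does the same to the Fourier coefficient, and ρ^k absorbs the change
  -- of radius.
  have h := (hA.smul ((c n * ρ ^ k n : ℝ) : ℂ)).2 i (j + k n)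
  rw [← sub_sub] at h
  rw [e, coef_mul_character, ← h, mul_smul_comm, map_smul, ← entryCLM_apply, map_smul,
    entryCLM_apply, entryCLM_apply, entry_mul_shift, smul_eq_mul, smul_eq_mul,
    zpow_sub₀ hρ.ne' (i - j) (k n)]
  have : ((ρ ^ k n : ℝ) : ℂ) ≠ 0 := by exact_mod_cast (zpow_pos hρ _).ne'
  push_cast at this ⊢
  field_simp

/-! ### Generators of the propagators -/

/-- The coefficient of the `(n+1)`-st shift in the generator at time distance `m + β`. -/
def stepCoeff (η β : ℝ) (m n : ℕ) : ℝ :=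
  Real.exp (-(η * (((n : ℝ) + 1) * (m + β)))) / ((n : ℝ) + 1)

/-- The coefficient of the `(n+1)`-st shift in the sum of the generators at time distances
`β, β + 1, …`. -/
def sumCoeff (η β : ℝ) (n : ℕ) : ℝ :=
  Real.exp (-(η * (((n : ℝ) + 1) * β))) / ((n : ℝ) + 1) / (1 - Real.exp (-(η * ((n : ℝ) + 1))))

theorem summable_exp_neg_mul {x : ℝ} (hx : 0 < x) : Summable fun n : ℕ => Real.exp (-(x * n)) := by
  have h := summable_geometric_of_lt_one (Real.exp_pos (-x)).le (Real.exp_lt_one_iff.2 (by linarith))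
  refine h.congr fun n => ?_
  rw [← Real.exp_nat_mul]; congr 1; ring

theorem hasSum_stepCoeff {η : ℝ} (hη : 0 < η) (β : ℝ) (n : ℕ) :
    HasSum (fun m => stepCoeff η β m n) (sumCoeff η β n) := by
  have h1 : Real.exp (-(η * ((n : ℝ) + 1))) < 1 := Real.exp_lt_one_iff.2 (by
    have : 0 < η * ((n : ℝ) + 1) := by positivity
    linarith)
  have h := (hasSum_geometric_of_lt_one (Real.exp_pos (-(η * ((n : ℝ) + 1)))).le h1).mul_left
    (Real.exp (-(η * (((n : ℝ) + 1) * β))) / ((n : ℝ) + 1))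
  unfold sumCoeff
  rw [div_eq_mul_inv _ (1 - _)]
  have e : (fun m => stepCoeff η β m n) = fun m : ℕ =>
      Real.exp (-(η * (((n : ℝ) + 1) * β))) / ((n : ℝ) + 1) *
        Real.exp (-(η * ((n : ℝ) + 1))) ^ m := by
    funext m
    rw [stepCoeff, ← Real.exp_nat_mul, div_mul_eq_mul_div, ← Real.exp_add]
    congr 2; ring
  rwa [e]

theorem summable_stepCoeff {η β : ℝ} (hη : 0 < η) (hβ : 1 / 2 ≤ β) :
    Summable fun p : ℕ × ℕ => stepCoeff η β p.1 p.2 := by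
  have h := (summable_exp_neg_mul (half_pos hη)).mul_of_nonneg (summable_exp_neg_mul (half_pos hη))
    (fun n => (Real.exp_pos _).le) (fun n => (Real.exp_pos _).le)
  refine Summable.of_nonneg_of_le (fun p => ?_) (fun p => ?_) h
  · unfold stepCoeff; positivity
  · unfold stepCoeff
    rw [← Real.exp_add]
    have hm : (0 : ℝ) ≤ p.1 := Nat.cast_nonneg _
    have hn : (0 : ℝ) ≤ p.2 := Nat.cast_nonneg _
    refine (div_le_self (Real.exp_pos _).le (by linarith)).trans (Real.exp_le_exp.2 ?_)
    -- Here β ≥ 1/2 enters: the exponent dominates half of m + n, so the double series is bounded by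
    -- a product of two geometric series.
    have : (p.1 : ℝ) / 2 + p.2 / 2 ≤ (p.2 + 1) * (p.1 + β) := by
      nlinarith [mul_nonneg hm hn, mul_nonneg hn (sub_nonneg.2 hβ)]
    nlinarith

/-- Absolute convergence of the double series over times and shifts allows summing over times first;
each shift then carries a geometric series. Only the bound on the norms of the shifts matters, so
one statement serves both directions. -/
theorem hasSum_stepCoeff_smul {E : Type*} [NormedAddCommGroup E] [NormedSpace ℂ E]
    [CompleteSpace E] {η β : ℝ} (hη : 0 < η) (hβ : 1 / 2 ≤ β) {S : ℕ → E} (hS : ∀ n, ‖S n‖ ≤ 1) :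
    (Summable fun m => ∑' n, ((stepCoeff η β m n : ℝ) : ℂ) • S n) ∧
      HasSum (fun n => ((sumCoeff η β n : ℝ) : ℂ) • S n)
        (∑' m, ∑' n, ((stepCoeff η β m n : ℝ) : ℂ) • S n) := by
  have hs : Summable fun p : ℕ × ℕ => ((stepCoeff η β p.1 p.2 : ℝ) : ℂ) • S p.2 := by
    refine Summable.of_norm_bounded (summable_stepCoeff hη hβ) fun p => ?_
    rw [norm_smul, Complex.norm_real, Real.norm_of_nonneg (by unfold stepCoeff; positivity)]
    exact mul_le_of_le_one_right (by unfold stepCoeff; positivity) (hS _)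
  refine ⟨hs.prod, ?_⟩
  have e : ∀ n, HasSum (fun m => ((stepCoeff η β m n : ℝ) : ℂ) • S n)
      (((sumCoeff η β n : ℝ) : ℂ) • S n) := fun n =>
    (Complex.hasSum_ofReal.2 (hasSum_stepCoeff hη β n)).smul_const _
  have h1 : HasSum (fun p : ℕ × ℕ => ((stepCoeff η β p.2 p.1 : ℝ) : ℂ) • S p.1)
      (∑' m, ∑' n, ((stepCoeff η β m n : ℝ) : ℂ) • S n) := by
    have := (Equiv.prodComm ℕ ℕ).hasSum_iff.2 hs.hasSum
    rwa [hs.tsum_prod] at this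
  exact h1.prod_fiberwise e

theorem stepGen_neg (η : ℝ) (m : ℕ) :
    stepGen (Real.exp (-η)) (-1 - (m : ℤ)) =
      ∑' n, ((stepCoeff η (1 / 2) m n : ℝ) : ℂ) • shift ((n : ℤ) + 1) := by
  unfold stepGen
  refine tsum_congr fun n => ?_
  have h1 : (-1 - (m : ℤ)) < 0 := by omega
  have h2 : |((-1 - (m : ℤ) : ℤ) : ℝ) + 1 / 2| = m + 1 / 2 := by
    have hm : (0 : ℝ) ≤ m := Nat.cast_nonneg _
    push_cast
    rw [abs_of_nonpos (by linarith)]; ring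
  rw [if_pos h1, h2, ← Real.exp_mul, stepCoeff, neg_mul]

theorem stepGen_nonneg (η : ℝ) (t m : ℕ) :
    stepGen (Real.exp (-η)) ((m + t : ℕ) : ℤ) =
      ∑' n, ((stepCoeff η (t + 1 / 2) m n : ℝ) : ℂ) • shift (-((n : ℤ) + 1)) := by
  unfold stepGen
  refine tsum_congr fun n => ?_
  have h1 : ¬ (((m + t : ℕ) : ℤ) < 0) := by omega
  have h2 : |(((m + t : ℕ) : ℤ) : ℝ) + 1 / 2| = m + (t + 1 / 2) := by
    rw [abs_of_nonneg (by positivity)]; push_cast; ring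
  rw [if_neg h1, h2, ← Real.exp_mul, stepCoeff, neg_mul]

theorem hasSum_upGen {η : ℝ} (hη : 0 < η) :
    HasSum (fun n : ℕ => ((sumCoeff η (1 / 2) n : ℝ) : ℂ) • shift ((n : ℤ) + 1))
      (upGen (Real.exp (-η))) := by
  unfold upGen
  simp only [stepGen_neg]
  exact (hasSum_stepCoeff_smul hη le_rfl fun _ => norm_shift_le _).2

/-- Subtracting the first t generators leaves the tail of the series for G_↓, that is, the same
geometric sums started at time distance t + 1/2. -/
theorem hasSum_downGen_sub_propGen {η : ℝ} (hη : 0 < η) (t : ℕ) :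
    HasSum (fun n : ℕ => ((sumCoeff η (t + 1 / 2) n : ℝ) : ℂ) • shift (-((n : ℤ) + 1)))
      (downGen (Real.exp (-η)) - propGen (Real.exp (-η)) t) := by
  have h1 : propGen (Real.exp (-η)) t = ∑ m ∈ Finset.range t, stepGen (Real.exp (-η)) m := by
    unfold propGen
    rw [if_pos (Int.natCast_nonneg t)]
    rw [Finset.range_eq_Ico]
    refine (Finset.sum_bij (fun (m : ℕ) _ => (m : ℤ)) ?_ ?_ ?_ ?_).symm
    · intro m hm; simp at hm ⊢; exact hm
    · intro a _ b _ h; exact_mod_cast h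
    · intro b hb
      rw [Finset.mem_Ico] at hb
      exact ⟨b.toNat, by simp; omega, by omega⟩
    · intros; rfl
  have h2 : Summable fun m : ℕ => stepGen (Real.exp (-η)) m := by
    have := (hasSum_stepCoeff_smul hη le_rfl (β := 1 / 2)
      (S := fun n => shift (-((n : ℤ) + 1))) fun _ => norm_shift_le _).1
    refine this.congr fun m => ?_
    have := stepGen_nonneg η 0 m
    simpa using this.symm
  rw [h1, downGen, ← h2.sum_add_tsum_nat_add t, add_sub_cancel_left]
  simp only [stepGen_nonneg]
  exact (hasSum_stepCoeff_smul hη (by linarith [Nat.cast_nonneg (α := ℝ) t])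
    fun _ => norm_shift_le _).2

/-! ### The action -/

/-- The Fourier weights of the action. -/
def weight (η u : ℝ) (n : ℕ) : ℝ :=
  Real.exp (-(((n : ℝ) + 1) * u / 2)) / (((n : ℝ) + 1) * Real.sinh (((n : ℝ) + 1) * η / 2))

/-- The odd function `w ↦ ∑_{k ≥ 1} e^{-ku/2} sinh (k w) / (k sinh (k η / 2))`, the logarithm of
the symbol of the wave operator at time `u / η` at the point `e^{-u/2+w}`. -/
def action (η u : ℝ) (w : ℂ) : ℂ :=
  ∑' n : ℕ, (weight η u n : ℂ) * Complex.sinh (((n : ℂ) + 1) * w)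

theorem weight_nonneg {η : ℝ} (hη : 0 < η) (u : ℝ) (n : ℕ) : 0 ≤ weight η u n := by
  unfold weight
  have : 0 < Real.sinh (((n : ℝ) + 1) * η / 2) := Real.sinh_pos_iff.2 (by positivity)
  positivity

theorem weight_le {η : ℝ} (hη : 0 < η) (u : ℝ) (n : ℕ) :
    weight η u n ≤ 2 / (η * ((n : ℝ) + 1) ^ 2) * Real.exp (-(((n : ℝ) + 1) * u / 2)) := by
  unfold weight
  have h : ((n : ℝ) + 1) * η / 2 ≤ Real.sinh (((n : ℝ) + 1) * η / 2) :=
    Real.self_le_sinh_iff.2 (by positivity)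
  rw [div_eq_mul_inv, mul_comm]
  refine mul_le_mul_of_nonneg_right ?_ (Real.exp_pos _).le
  rw [← inv_div (η * ((n : ℝ) + 1) ^ 2) 2]
  refine inv_anti₀ (by positivity) ?_
  calc η * ((n : ℝ) + 1) ^ 2 / 2 = ((n : ℝ) + 1) * (((n : ℝ) + 1) * η / 2) := by ring
    _ ≤ _ := by gcongr

theorem summable_weight_mul_exp {η u s : ℝ} (hη : 0 < η) (hs : s < u / 2) :
    Summable fun n : ℕ => weight η u n * Real.exp (((n : ℝ) + 1) * s) := by
  have h := ((summable_exp_neg_mul (sub_pos.2 hs)).comp_injective Nat.succ_injective).mul_left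
    (2 / η)
  refine Summable.of_nonneg_of_le (fun n => ?_) (fun n => ?_) h
  · exact mul_nonneg (weight_nonneg hη _ _) (Real.exp_pos _).le
  · have h1 : 2 / (η * ((n : ℝ) + 1) ^ 2) ≤ 2 / η := by
      gcongr
      have : (0 : ℝ) ≤ n := Nat.cast_nonneg _
      exact le_mul_of_one_le_right hη.le (one_le_pow₀ (by linarith))
    calc _ ≤ 2 / η * Real.exp (-(((n : ℝ) + 1) * u / 2)) * Real.exp (((n : ℝ) + 1) * s) := by
          gcongr
          exact (weight_le hη u n).trans (by gcongr)
      _ = _ := by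
          rw [mul_assoc, ← Real.exp_add]
          simp only [Function.comp, Nat.succ_eq_add_one]
          push_cast
          congr 2; ring

theorem norm_sinh_le (z : ℂ) : ‖Complex.sinh z‖ ≤ Real.exp |z.re| := by
  have h1 : ‖Complex.exp z‖ ≤ Real.exp |z.re| := by
    rw [Complex.norm_exp]; exact Real.exp_le_exp.2 (le_abs_self _)
  have h2 : ‖Complex.exp (-z)‖ ≤ Real.exp |z.re| := by
    rw [Complex.norm_exp, Complex.neg_re]; exact Real.exp_le_exp.2 (neg_le_abs _)
  rw [Complex.sinh, norm_div, Complex.norm_ofNat]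
  linarith [norm_sub_le (Complex.exp z) (Complex.exp (-z))]

theorem summable_action {η u : ℝ} (hη : 0 < η) {w : ℂ} (hw : |w.re| < u / 2) :
    Summable fun n : ℕ => (weight η u n : ℂ) * Complex.sinh (((n : ℂ) + 1) * w) := by
  refine Summable.of_norm_bounded (summable_weight_mul_exp hη hw) fun n => ?_
  rw [norm_mul, Complex.norm_real, Real.norm_of_nonneg (weight_nonneg hη _ _)]
  refine mul_le_mul_of_nonneg_left ((norm_sinh_le _).trans_eq ?_) (weight_nonneg hη _ _)
  have : (((n : ℂ) + 1) * w).re = ((n : ℝ) + 1) * w.re := by simp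
  rw [this, abs_mul, abs_of_nonneg (by positivity)]

theorem action_neg (η u : ℝ) (w : ℂ) : action η u (-w) = -action η u w := by
  unfold action
  rw [← tsum_neg]
  refine tsum_congr fun n => ?_
  rw [mul_neg, Complex.sinh_neg, mul_neg]

/-- Taking e^{-kη/2} out of 1 - e^{-kη} leaves 2 sinh(kη/2), and the shift by 1/2 in the time
distance cancels that factor. The case v = 0 gives the up coefficients, v = ηt the down
coefficients. -/
theorem sumCoeff_eq (η : ℝ) (hη : 0 < η) (v : ℝ) (n : ℕ) :
    sumCoeff η (v / η + 1 / 2) n = weight η (2 * v) n / 2 := by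
  have hs : 0 < Real.sinh (((n : ℝ) + 1) * η / 2) := Real.sinh_pos_iff.2 (by positivity)
  have hp : 1 - Real.exp (-(η * ((n : ℝ) + 1))) =
      2 * Real.sinh (((n : ℝ) + 1) * η / 2) * Real.exp (-(((n : ℝ) + 1) * η / 2)) := by
    rw [Real.sinh_eq, mul_div_cancel₀ _ two_ne_zero, sub_mul, ← Real.exp_add, ← Real.exp_add]
    rw [show ((n : ℝ) + 1) * η / 2 + -(((n : ℝ) + 1) * η / 2) = 0 by ring, Real.exp_zero]
    congr 2; ring
  have hn : Real.exp (-(η * (((n : ℝ) + 1) * (v / η + 1 / 2)))) =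
      Real.exp (-(((n : ℝ) + 1) * (2 * v) / 2)) * Real.exp (-(((n : ℝ) + 1) * η / 2)) := by
    rw [← Real.exp_add]; congr 1; field_simp; ring
  have := Real.exp_pos (-(((n : ℝ) + 1) * η / 2))
  rw [sumCoeff, weight, hp, hn]
  field_simp

/-! ### Wave functions -/

/-- The conjugated one-particle wave function, as an integral over the vertical segment with
abscissa `σ`. -/
def wave (η u σ : ℝ) (x : ℤ) : ℂ :=
  (2 * (Real.pi : ℂ))⁻¹ * ∫ θ in (-Real.pi)..Real.pi,
    Complex.exp (action η u (σ + θ * Complex.I) - x * (σ + θ * Complex.I))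

theorem exp_zpow (a : ℝ) (n : ℤ) : Real.exp a ^ n = Real.exp (n * a) := by
  rw [← Real.rpow_intCast, ← Real.exp_mul, mul_comm]

/-- On the radius e^{-u/2+σ} the up coefficients pick up e^{-ku/2}, while in `down_coeff` the down
coefficients lose half of their e^{-ku}. Both then carry the same weight, with e^{kσ} and e^{-kσ},
so that their difference is a hyperbolic sine. -/
theorem up_coeff {η : ℝ} (hη : 0 < η) (u σ : ℝ) (n : ℕ) :
    sumCoeff η (1 / 2) n * Real.exp (-u / 2 + σ) ^ ((n : ℤ) + 1) =
      weight η u n / 2 * Real.exp (((n : ℝ) + 1) * σ) := by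
  have h := sumCoeff_eq η hη 0 n
  rw [zero_div, zero_add] at h
  have e : Real.exp ((((n : ℤ) + 1 : ℤ) : ℝ) * (-u / 2 + σ)) =
      Real.exp (-(((n : ℝ) + 1) * u / 2)) * Real.exp (((n : ℝ) + 1) * σ) := by
    rw [← Real.exp_add]; congr 1; push_cast; ring
  have hs : 0 < Real.sinh (((n : ℝ) + 1) * η / 2) := Real.sinh_pos_iff.2 (by positivity)
  rw [h, exp_zpow, e, weight, weight]
  simp
  field_simp

theorem down_coeff {η : ℝ} (hη : 0 < η) (t σ : ℝ) (n : ℕ) :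
    sumCoeff η (t + 1 / 2) n * Real.exp (-(η * t) / 2 + σ) ^ (-((n : ℤ) + 1)) =
      weight η (η * t) n / 2 * Real.exp (-(((n : ℝ) + 1) * σ)) := by
  have h := sumCoeff_eq η hη (η * t) n
  rw [mul_div_cancel_left₀ _ hη.ne'] at h
  have e : Real.exp (-(((n : ℝ) + 1) * (2 * (η * t)) / 2)) *
      Real.exp (((-((n : ℤ) + 1) : ℤ) : ℝ) * (-(η * t) / 2 + σ)) =
      Real.exp (-(((n : ℝ) + 1) * (η * t) / 2)) * Real.exp (-(((n : ℝ) + 1) * σ)) := by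
    rw [← Real.exp_add, ← Real.exp_add]; congr 1; push_cast; ring
  rw [h, exp_zpow, weight, weight, div_div, div_mul_eq_mul_div, e, div_div, div_mul_eq_mul_div]

theorem hasSymbol_generator {η : ℝ} (hη : 0 < η) (t : ℕ) {σ : ℝ} (hσ : |σ| < η * t / 2) :
    HasSymbol (Real.exp (-(η * t) / 2 + σ))
      (upGen (Real.exp (-η)) - downGen (Real.exp (-η)) + propGen (Real.exp (-η)) t)
      (fun θ => action η (η * t) (σ + θ * Complex.I)) := by
  set u := η * (t : ℝ) with hu
  have hc1 : ∀ n, 0 ≤ weight η u n := weight_nonneg hη u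
  have hpos : ∀ β n, 0 ≤ sumCoeff η β n := by
    intro β n
    have := Real.exp_lt_one_iff.2 (show -(η * ((n : ℝ) + 1)) < 0 by
      have : 0 < η * ((n : ℝ) + 1) := by positivity
      linarith)
    unfold sumCoeff
    have : 0 < 1 - Real.exp (-(η * ((n : ℝ) + 1))) := by linarith
    positivity
  have s1 : Summable fun n => weight η u n / 2 * Real.exp (((n : ℝ) + 1) * σ) :=
    ((summable_weight_mul_exp hη ((le_abs_self σ).trans_lt hσ)).div_const 2).congr
      fun n => by ring
  have s2 : Summable fun n => weight η u n / 2 * Real.exp (-(((n : ℝ) + 1) * σ)) :=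
    ((summable_weight_mul_exp hη ((neg_le_abs σ).trans_lt hσ)).div_const 2).congr
      fun n => by rw [mul_neg]; ring
  have h1 := hasSymbol_of_hasSum (Real.exp_pos (-u / 2 + σ)) (hasSum_upGen hη)
    (by simpa only [abs_of_nonneg (hpos _ _), up_coeff hη] using s1)
  have h2 := hasSymbol_of_hasSum (Real.exp_pos (-u / 2 + σ)) (hasSum_downGen_sub_propGen hη t)
    (by simpa only [abs_of_nonneg (hpos _ _), down_coeff hη, hu] using s2)
  have h3 := h1.sub h2
  rw [show upGen (Real.exp (-η)) - downGen (Real.exp (-η)) + propGen (Real.exp (-η)) t =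
    upGen (Real.exp (-η)) - (downGen (Real.exp (-η)) - propGen (Real.exp (-η)) t) by abel]
  convert h3 using 1
  funext θ
  simp only [hu, down_coeff hη, up_coeff hη]
  simp only [← hu]
  rw [← Summable.tsum_sub]
  · unfold action
    refine tsum_congr fun n => ?_
    have e1 : ((Real.exp (((n : ℝ) + 1) * σ) : ℝ) : ℂ) * character ((n : ℤ) + 1) θ =
        Complex.exp (((n : ℂ) + 1) * (σ + θ * Complex.I)) := by
      rw [character, Complex.ofReal_exp, ← Complex.exp_add]
      congr 1; push_cast; ring
    have e2 : ((Real.exp (-(((n : ℝ) + 1) * σ)) : ℝ) : ℂ) * character (-((n : ℤ) + 1)) θ =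
        Complex.exp (-(((n : ℂ) + 1) * (σ + θ * Complex.I))) := by
      rw [character, Complex.ofReal_exp, ← Complex.exp_add]
      congr 1; push_cast; ring
    rw [Complex.ofReal_mul, Complex.ofReal_mul, mul_assoc, mul_assoc, e1, e2, Complex.sinh]
    push_cast; ring
  · refine Summable.of_norm ?_
    refine s1.congr fun n => ?_
    rw [norm_mul, norm_character, mul_one, Complex.norm_real, Real.norm_of_nonneg]
    have := hc1 n; positivity
  · refine Summable.of_norm ?_
    refine s2.congr fun n => ?_
    rw [norm_mul, norm_character, mul_one, Complex.norm_real, Real.norm_of_nonneg]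
    have := hc1 n; positivity

theorem wave_eq_coef (η u σ : ℝ) (x : ℤ) :
    wave η u σ x = ((Real.exp (-(x * σ)) : ℝ) : ℂ) *
      coef (fun θ => Complex.exp (action η u (σ + θ * Complex.I))) x := by
  unfold wave coef
  rw [mul_left_comm]
  congr 1
  rw [← intervalIntegral.integral_const_mul]
  refine intervalIntegral.integral_congr fun θ _ => ?_
  simp only [Complex.ofReal_exp]
  rw [← Complex.exp_add, ← Complex.exp_add]
  congr 1; push_cast; ring

/-- Oddness of the action together with θ ↦ -θ turns the symbol of the inverse operator at abscissa
-σ into that of the operator at σ, with the opposite Fourier index. -/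
theorem wave_eq_coef_neg (η u σ : ℝ) (x : ℤ) :
    wave η u σ x = ((Real.exp (-(x * σ)) : ℝ) : ℂ) *
      coef (fun θ => Complex.exp (-action η u ((-σ : ℝ) + θ * Complex.I))) (-x) := by
  unfold wave coef
  rw [mul_left_comm]
  congr 1
  rw [← intervalIntegral.integral_const_mul]
  have := intervalIntegral.integral_comp_neg (a := -Real.pi) (b := Real.pi)
    (fun θ : ℝ => Complex.exp (action η u (σ + θ * Complex.I) - x * (σ + θ * Complex.I)))
  rw [neg_neg] at this
  rw [← this]
  refine intervalIntegral.integral_congr fun θ _ => ?_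
  simp only [Complex.ofReal_exp, ← action_neg]
  rw [← Complex.exp_add, ← Complex.exp_add]
  have e : -(((-σ : ℝ) : ℂ) + θ * Complex.I) = σ + ((-θ : ℝ) : ℂ) * Complex.I := by
    push_cast; ring
  rw [e]
  congr 1; push_cast; ring

theorem entry_waveOp {η : ℝ} (hη : 0 < η) (t : ℕ) {σ : ℝ} (hσ : |σ| < η * t / 2) (i j : ℤ) :
    entry (waveOp (Real.exp (-η)) t) i j =
      ((Real.exp (((i - j : ℤ) : ℝ) * (η * t) / 2) : ℝ) : ℂ) * wave η (η * t) σ (i - j) := by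
  have h := (hasSymbol_generator hη t hσ).exp.2 i j
  rw [exp_zpow] at h
  rw [wave_eq_coef, ← h, waveOp, ← mul_assoc, ← mul_assoc, ← Complex.ofReal_mul,
    ← Complex.ofReal_mul, ← Real.exp_add, ← Real.exp_add]
  ring_nf
  simp

theorem entry_waveOpInv {η : ℝ} (hη : 0 < η) (t : ℕ) {σ : ℝ} (hσ : |σ| < η * t / 2) (l j : ℤ) :
    entry (waveOpInv (Real.exp (-η)) t) l j =
      ((Real.exp (-(((j - l : ℤ) : ℝ) * (η * t) / 2)) : ℝ) : ℂ) * wave η (η * t) σ (j - l) := by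
  have h := (hasSymbol_generator hη t (σ := -σ) (by rwa [abs_neg])).neg.exp.2 l j
  have e : -(upGen (Real.exp (-η)) - downGen (Real.exp (-η)) + propGen (Real.exp (-η)) t) =
      -upGen (Real.exp (-η)) + downGen (Real.exp (-η)) - propGen (Real.exp (-η)) t := by abel
  rw [exp_zpow, e] at h
  rw [wave_eq_coef_neg, neg_sub, ← h, waveOpInv, ← mul_assoc, ← mul_assoc, ← Complex.ofReal_mul,
    ← Complex.ofReal_mul, ← Real.exp_add, ← Real.exp_add]
  have : -(((j - l : ℤ) : ℝ) * (η * t) / 2) + (-(((j - l : ℤ) : ℝ) * σ) +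
      ((l - j : ℤ) : ℝ) * (-(η * t) / 2 + -σ)) = 0 := by push_cast; ring
  rw [add_assoc, this]; simp

theorem creAnn_eq {η : ℝ} (hη : 0 < η) (t t' : ℕ) {σ : ℝ} (hσ : |σ| < η * t / 2)
    (hσ' : |σ| < η * t' / 2) (j j' : ℤ) :
    creAnn (Real.exp (-η)) j t j' t' =
      ((Real.exp (j' * (η * t') / 2 - j * (η * t) / 2) : ℝ) : ℂ) *
        ∑' n : ℕ, ((Real.exp (-(n * (η * t - η * t') / 2)) : ℝ) : ℂ) *
          (wave η (η * t') σ (j' + n) * wave η (η * t) σ (j + n)) := by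
  -- The filled sites are l = -n with n ≥ 0, so the sum includes n = 0 and moves the positions to
  -- the right.
  let e : ℕ ≃ {l : ℤ // l ≤ 0} :=
    { toFun := fun n => ⟨-(n : ℤ), by omega⟩
      invFun := fun l => (-l.1).toNat
      left_inv := fun n => by simp
      right_inv := fun l => by ext; have := l.2; simp; omega }
  rw [creAnn, ← e.tsum_eq, ← tsum_mul_left]
  refine tsum_congr fun n => ?_
  simp only [e, Equiv.coe_fn_mk]
  rw [entry_waveOp hη t' hσ', entry_waveOpInv hη t hσ, sub_neg_eq_add, sub_neg_eq_add,
    ← mul_assoc (Complex.ofReal _), ← Complex.ofReal_mul, ← Real.exp_add, mul_mul_mul_comm,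
    ← Complex.ofReal_mul, ← Real.exp_add]
  congr 3
  push_cast; ring_nf

theorem annCre_eq {η : ℝ} (hη : 0 < η) (t t' : ℕ) {σ : ℝ} (hσ : |σ| < η * t / 2)
    (hσ' : |σ| < η * t' / 2) (j j' : ℤ) :
    annCre (Real.exp (-η)) j' t' j t =
      ((Real.exp (j' * (η * t') / 2 - j * (η * t) / 2) : ℝ) : ℂ) *
        ∑' n : ℕ, ((Real.exp (-((n + 1) * (η * t' - η * t) / 2)) : ℝ) : ℂ) *
          (wave η (η * t') σ (j' - (n + 1)) * wave η (η * t) σ (j - (n + 1))) := by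
  -- The empty sites start at l = 1, whence n + 1 and displacements to the left.
  let e : ℕ ≃ {l : ℤ // 0 < l} :=
    { toFun := fun n => ⟨(n : ℤ) + 1, by omega⟩
      invFun := fun l => (l.1 - 1).toNat
      left_inv := fun n => by simp
      right_inv := fun l => by ext; have := l.2; simp; omega }
  rw [annCre, ← e.tsum_eq, ← tsum_mul_left]
  refine tsum_congr fun n => ?_
  simp only [e, Equiv.coe_fn_mk]
  rw [entry_waveOp hη t' hσ', entry_waveOpInv hη t hσ,
    ← mul_assoc (Complex.ofReal _), ← Complex.ofReal_mul, ← Real.exp_add, mul_mul_mul_comm,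
    ← Complex.ofReal_mul, ← Real.exp_add]
  congr 3
  push_cast; ring_nf

/-! ### Asymptotics of the action -/

/-- The derivative of the action at the origin. -/
def edgeSlope (η u : ℝ) : ℝ :=
  ∑' n : ℕ, Real.exp (-(((n : ℝ) + 1) * u / 2)) / Real.sinh (((n : ℝ) + 1) * η / 2)

theorem norm_sinh_sub_le (z : ℂ) : ‖Complex.sinh z - z‖ ≤ ‖z‖ ^ 3 * Real.exp ‖z‖ := by
  have h1 := Complex.norm_exp_sub_sum_le_norm_mul_exp z 3
  have h2 := Complex.norm_exp_sub_sum_le_norm_mul_exp (-z) 3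
  rw [norm_neg] at h2
  simp only [Finset.sum_range_succ, Finset.sum_range_zero] at h1 h2
  have e : Complex.sinh z - z =
      ((Complex.exp z - (0 + z ^ 0 / (Nat.factorial 0 : ℂ) + z ^ 1 / (Nat.factorial 1 : ℂ) +
        z ^ 2 / (Nat.factorial 2 : ℂ))) -
      (Complex.exp (-z) - (0 + (-z) ^ 0 / (Nat.factorial 0 : ℂ) + (-z) ^ 1 / (Nat.factorial 1 : ℂ) +
        (-z) ^ 2 / (Nat.factorial 2 : ℂ)))) / 2 := by
    rw [Complex.sinh]; simp [Nat.factorial]; ring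
  rw [e, norm_div, Complex.norm_ofNat, div_le_iff₀ two_pos]
  exact (norm_sub_le _ _).trans (by linarith)

theorem norm_sinh_sub_cubic_le (z : ℂ) :
    ‖Complex.sinh z - z - z ^ 3 / 6‖ ≤ ‖z‖ ^ 5 * Real.exp ‖z‖ := by
  have h1 := Complex.norm_exp_sub_sum_le_norm_mul_exp z 5
  have h2 := Complex.norm_exp_sub_sum_le_norm_mul_exp (-z) 5
  rw [norm_neg] at h2
  have e : Complex.sinh z - z - z ^ 3 / 6 =
      ((Complex.exp z - ∑ m ∈ Finset.range 5, z ^ m / (m.factorial : ℂ)) -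
      (Complex.exp (-z) - ∑ m ∈ Finset.range 5, (-z) ^ m / (m.factorial : ℂ))) / 2 := by
    rw [Complex.sinh]; simp [Finset.sum_range_succ, Nat.factorial]; ring
  rw [e, norm_div, Complex.norm_ofNat, div_le_iff₀ two_pos]
  exact (norm_sub_le _ _).trans (by linarith)

theorem weight_mul (η : ℝ) (u : ℝ) (n : ℕ) :
    weight η u n * ((n : ℝ) + 1) =
      Real.exp (-(((n : ℝ) + 1) * u / 2)) / Real.sinh (((n : ℝ) + 1) * η / 2) := by
  have : (n : ℝ) + 1 ≠ 0 := by positivity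
  rw [weight]; field_simp

theorem summable_succ_mul_exp {x : ℝ} (hx : 0 < x) :
    Summable fun n : ℕ => ((n : ℝ) + 1) * Real.exp (-(((n : ℝ) + 1) * x)) := by
  have h := (Real.summable_pow_mul_exp_neg_nat_mul 1 hx).comp_injective Nat.succ_injective
  refine h.congr fun n => ?_
  simp only [Function.comp, pow_one, Nat.succ_eq_add_one]
  push_cast
  congr 2; ring

/-- The weight contributes 1/(ηk²) and the cubic remainder of sinh contributes k³‖w‖³. With w of
order 1/N and η of order N⁻³ the prefactor stays bounded, which makes this a summable majorant
independent of N. -/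
theorem norm_cubic_term_le {η : ℝ} (hη : 0 < η) (u : ℝ) (w : ℂ) (n : ℕ) :
    ‖(weight η u n : ℂ) * (Complex.sinh (((n : ℂ) + 1) * w) - ((n : ℂ) + 1) * w)‖ ≤
      2 * ‖w‖ ^ 3 / η * (((n : ℝ) + 1) * Real.exp (-(((n : ℝ) + 1) * (u / 2 - ‖w‖)))) := by
  have hk : ‖((n : ℂ) + 1) * w‖ = ((n : ℝ) + 1) * ‖w‖ := by
    rw [norm_mul]; congr 1
    exact_mod_cast Complex.norm_natCast (n + 1)
  have h := norm_sinh_sub_le (((n : ℂ) + 1) * w)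
  rw [hk] at h
  rw [norm_mul, Complex.norm_real, Real.norm_of_nonneg (weight_nonneg hη _ _)]
  calc _ ≤ (2 / (η * ((n : ℝ) + 1) ^ 2) * Real.exp (-(((n : ℝ) + 1) * u / 2))) *
        ((((n : ℝ) + 1) * ‖w‖) ^ 3 * Real.exp (((n : ℝ) + 1) * ‖w‖)) := by
        gcongr
        exact weight_le hη u n
    _ = 2 * ‖w‖ ^ 3 / η * (((n : ℝ) + 1) *
        (Real.exp (-(((n : ℝ) + 1) * u / 2)) * Real.exp (((n : ℝ) + 1) * ‖w‖))) := by
        field_simp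
    _ = _ := by rw [← Real.exp_add]; congr 3; ring

theorem summable_weight_mul {η u : ℝ} (hη : 0 < η) (hu : 0 < u) :
    Summable fun n : ℕ => weight η u n * ((n : ℝ) + 1) := by
  refine Summable.of_nonneg_of_le (fun n => ?_) (fun n => ?_)
    ((summable_succ_mul_exp (half_pos hu)).mul_left (2 / η))
  · exact mul_nonneg (weight_nonneg hη _ _) (by positivity)
  · have h1 : 2 / (η * ((n : ℝ) + 1) ^ 2) ≤ 2 / η := by
      gcongr
      have : (0 : ℝ) ≤ n := Nat.cast_nonneg _
      exact le_mul_of_one_le_right hη.le (one_le_pow₀ (by linarith))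
    calc _ ≤ (2 / η * Real.exp (-(((n : ℝ) + 1) * u / 2))) * ((n : ℝ) + 1) := by
          gcongr
          exact (weight_le hη u n).trans (by gcongr)
      _ = _ := by rw [mul_div_assoc]; ring

theorem action_sub_slope {η u : ℝ} (hη : 0 < η) {w : ℂ} (hw : |w.re| < u / 2) :
    action η u w - edgeSlope η u * w =
      ∑' n : ℕ, (weight η u n : ℂ) * (Complex.sinh (((n : ℂ) + 1) * w) - ((n : ℂ) + 1) * w) := by
  have hu : 0 < u := by linarith [abs_nonneg w.re]
  have h1 := (Complex.hasSum_ofReal.2 (summable_weight_mul hη hu).hasSum).mul_right w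
  simp only [weight_mul] at h1
  rw [action, edgeSlope, ← ((summable_action hη hw).hasSum.sub h1).tsum_eq]
  refine tsum_congr fun n => ?_
  rw [← weight_mul]; push_cast; ring

theorem continuous_action {η u σ : ℝ} (hη : 0 < η) (hσ : |σ| < u / 2) :
    Continuous fun θ : ℝ => action η u (σ + θ * Complex.I) := by
  unfold action
  refine continuous_tsum (u := fun n : ℕ => weight η u n * Real.exp (((n : ℝ) + 1) * |σ|))
    (fun n => by fun_prop) (summable_weight_mul_exp hη hσ) fun n θ => ?_
  rw [norm_mul, Complex.norm_real, Real.norm_of_nonneg (weight_nonneg hη _ _)]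
  refine mul_le_mul_of_nonneg_left ((norm_sinh_le _).trans_eq ?_) (weight_nonneg hη _ _)
  have : (((n : ℂ) + 1) * (σ + θ * Complex.I)).re = ((n : ℝ) + 1) * σ := by simp
  rw [this, abs_mul, abs_of_nonneg (by positivity : (0 : ℝ) ≤ (n : ℝ) + 1)]

/-- The real part of the action decays along vertical lines. -/
theorem action_re_le {η u σ θ : ℝ} (hη : 0 < η) (hσ0 : 0 ≤ σ) (hσ : σ < u / 2)
    (hθ : |θ| ≤ Real.pi) :
    (action η u (σ + θ * Complex.I)).re ≤
      (action η u σ).re - weight η u 0 * (σ * (2 / Real.pi ^ 2 * θ ^ 2)) := by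
  have hσ' : |σ| < u / 2 := by rwa [abs_of_nonneg hσ0]
  have h1 := Complex.hasSum_re (summable_action (u := u) hη (w := σ + θ * Complex.I)
    (by simpa using hσ')).hasSum
  have h2 := Complex.hasSum_re (summable_action (u := u) hη (w := σ) (by simpa using hσ')).hasSum
  have h3 := h2.sub h1
  have e : ∀ n : ℕ, ((weight η u n : ℂ) * Complex.sinh (((n : ℂ) + 1) * σ)).re -
      ((weight η u n : ℂ) * Complex.sinh (((n : ℂ) + 1) * (σ + θ * Complex.I))).re =
      weight η u n * (Real.sinh (((n : ℝ) + 1) * σ) * (1 - Real.cos (((n : ℝ) + 1) * θ))) := by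
    intro n
    have a1 : ((n : ℂ) + 1) * (σ + θ * Complex.I) =
        (((n + 1) * σ : ℝ) : ℂ) + (((n + 1) * θ : ℝ) : ℂ) * Complex.I := by push_cast; ring
    have a2 : ((n : ℂ) + 1) * σ = (((n + 1) * σ : ℝ) : ℂ) := by push_cast; ring
    rw [a1, a2, Complex.re_ofReal_mul, Complex.re_ofReal_mul, Complex.sinh_add, Complex.sinh_mul_I,
      Complex.cosh_mul_I, ← Complex.ofReal_sinh, ← Complex.ofReal_cos, ← Complex.ofReal_cosh,
      ← Complex.ofReal_sin, Complex.add_re, ← Complex.ofReal_mul, ← mul_assoc,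
      ← Complex.ofReal_mul, Complex.re_ofReal_mul]
    simp only [Complex.ofReal_re, Complex.I_re]
    ring
  simp only [e] at h3
  -- Every mode lowers the real part by a nonnegative amount; keeping only the first one is already
  -- enough for Gaussian decay.
  have h4 := le_hasSum h3 0 fun n _ => mul_nonneg (weight_nonneg hη u n)
    (mul_nonneg (Real.sinh_nonneg_iff.2 (by positivity)) (by linarith [Real.cos_le_one (((n : ℝ) + 1) * θ)]))
  have h5 : σ * (2 / Real.pi ^ 2 * θ ^ 2) ≤ Real.sinh σ * (1 - Real.cos θ) := by
    refine mul_le_mul (Real.self_le_sinh_iff.2 hσ0) ?_ (by positivity) (Real.sinh_nonneg_iff.2 hσ0)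
    linarith [Real.cos_le_one_sub_mul_cos_sq hθ]
  have h6 := mul_le_mul_of_nonneg_left h5 (weight_nonneg hη u 0)
  simp only [Nat.cast_zero, zero_add, one_mul] at h4
  unfold action at *
  linarith

/-! ### Scaling limit of the wave functions -/

/-- The scaling regime of the edge: the lattice is refined at the rate `N → ∞` while the step `η`
behaves like `N⁻³` and the rescaled time `u` has a positive limit `τ`. -/
structure EdgeRegime {ι : Type*} (L : Filter ι) (N η u : ι → ℝ) (τ : ℝ) : Prop where
  pos : 0 < τ
  tendsto_scale : Tendsto N L atTop
  step_pos : ∀ᶠ i in L, 0 < η i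
  tendsto_step : Tendsto (fun i => η i * N i ^ 3) L (𝓝 1)
  tendsto_time : Tendsto u L (𝓝 τ)

/-- The coefficient of the cubic term of the limiting action. -/
def cubicCoeff (τ : ℝ) : ℝ := Real.exp (-τ / 2) / (1 - Real.exp (-τ / 2)) ^ 2

/-- The integral of `exp (c v ^ 3 / 3 - ξ v)` along the vertical line with abscissa `σ`. -/
def cubicLine (c σ ξ : ℝ) : ℂ :=
  (2 * (Real.pi : ℂ))⁻¹ * ∫ y : ℝ,
    Complex.exp (c * (σ + y * Complex.I) ^ 3 / 3 - ξ * (σ + y * Complex.I))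

section

variable {ι : Type*} {L : Filter ι} {N η u : ι → ℝ} {τ : ℝ}

/-- The Taylor remainder of order five is O(N⁻⁵), so it vanishes after multiplication by N³. -/
theorem tendsto_sinh_cubic (hN : Tendsto N L atTop) (z : ℂ) :
    Tendsto (fun i => (N i : ℂ) ^ 3 * (Complex.sinh (z / N i) - z / N i)) L (𝓝 (z ^ 3 / 6)) := by
  rw [tendsto_iff_norm_sub_tendsto_zero]
  have hb : Tendsto (fun i => ‖z‖ ^ 5 * Real.exp ‖z‖ * (N i)⁻¹ ^ 2) L (𝓝 0) := by
    have := ((tendsto_inv_atTop_zero.comp hN).pow 2).const_mul (‖z‖ ^ 5 * Real.exp ‖z‖)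
    simpa using this
  refine squeeze_zero' (Eventually.of_forall fun i => norm_nonneg _) ?_ hb
  filter_upwards [hN.eventually_ge_atTop 1] with i hi
  have hi0 : 0 < N i := by linarith
  have hc : (N i : ℂ) ≠ 0 := by exact_mod_cast hi0.ne'
  have h := norm_sinh_sub_cubic_le (z / N i)
  have hz : ‖z / (N i : ℂ)‖ = ‖z‖ / N i := by
    rw [norm_div, Complex.norm_real, Real.norm_of_nonneg hi0.le]
  rw [hz] at h
  have e : (N i : ℂ) ^ 3 * (Complex.sinh (z / N i) - z / N i) - z ^ 3 / 6 =
      (N i : ℂ) ^ 3 * (Complex.sinh (z / N i) - z / N i - (z / N i) ^ 3 / 6) := by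
    field_simp
  rw [e, norm_mul, norm_pow, Complex.norm_real, Real.norm_of_nonneg hi0.le]
  calc _ ≤ N i ^ 3 * ((‖z‖ / N i) ^ 5 * Real.exp (‖z‖ / N i)) := by gcongr
    _ ≤ N i ^ 3 * ((‖z‖ / N i) ^ 5 * Real.exp ‖z‖) := by
        gcongr
        exact div_le_self (norm_nonneg _) hi
    _ = _ := by field_simp

theorem EdgeRegime.step_tendsto_zero (h : EdgeRegime L N η u τ) : Tendsto η L (𝓝 0) := by
  have h1 : Tendsto (fun i => η i * N i ^ 3 * (N i)⁻¹ ^ 3) L (𝓝 0) := by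
    simpa using h.tendsto_step.mul ((tendsto_inv_atTop_zero.comp h.tendsto_scale).pow 3)
  refine h1.congr' ?_
  filter_upwards [h.tendsto_scale.eventually_gt_atTop 0] with i hi
  field_simp

theorem EdgeRegime.tendsto_sinh_step (h : EdgeRegime L N η u τ) (k : ℝ) :
    Tendsto (fun i => N i ^ 3 * Real.sinh (k * η i / 2)) L (𝓝 (k / 2)) := by
  have h1 : Tendsto (fun i => dslope Real.sinh 0 (k * η i / 2)) L (𝓝 1) := by
    have hd : DifferentiableAt ℝ Real.sinh 0 := Real.differentiable_sinh 0
    have hc : ContinuousAt (dslope Real.sinh 0) 0 := continuousAt_dslope_same.2 hd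
    have : dslope Real.sinh 0 0 = 1 := by rw [dslope_same, Real.deriv_sinh, Real.cosh_zero]
    rw [ContinuousAt, this] at hc
    refine hc.comp ?_
    simpa using (h.step_tendsto_zero.const_mul k).div_const 2
  have h2 := (h.tendsto_step.mul h1).const_mul (k / 2)
  rw [one_mul, mul_one] at h2
  refine h2.congr fun i => ?_
  have := sub_smul_dslope Real.sinh 0 (k * η i / 2)
  rw [Real.sinh_zero, sub_zero, sub_zero, smul_eq_mul] at this
  rw [← this]; ring

theorem tsum_cubicCoeff {τ : ℝ} (hτ : 0 < τ) (v : ℂ) :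
    ∑' n : ℕ, ((((n : ℝ) + 1) * Real.exp (-(((n : ℝ) + 1) * τ / 2)) : ℝ) : ℂ) * (v ^ 3 / 3) =
      cubicCoeff τ * v ^ 3 / 3 := by
  have ha : Real.exp (-τ / 2) < 1 := Real.exp_lt_one_iff.2 (by linarith)
  have h1 := hasSum_coe_mul_geometric_of_norm_lt_one (𝕜 := ℝ) (r := Real.exp (-τ / 2))
    (by rwa [Real.norm_of_nonneg (Real.exp_pos _).le])
  rw [← hasSum_nat_add_iff' 1] at h1
  simp only [Finset.range_one, Finset.sum_singleton, Nat.cast_zero, zero_mul, sub_zero] at h1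
  have h2 := (Complex.hasSum_ofReal.2 h1).mul_right (v ^ 3 / 3)
  rw [mul_div_assoc, cubicCoeff, ← h2.tsum_eq]
  refine tsum_congr fun n => ?_
  rw [← Real.exp_nat_mul]
  push_cast
  congr 4; ring

/-- Once the linear part is removed, each mode is a cubic term of size N⁻³ times a weight of size
N³. The limits of the modes sum to the series ∑ k e^{-kτ/2} evaluated in `tsum_cubicCoeff`;
dominated convergence exchanges limit and sum. -/
theorem EdgeRegime.tendsto_action (h : EdgeRegime L N η u τ) (v : ℂ) :
    Tendsto (fun i => action (η i) (u i) (v / N i) - edgeSlope (η i) (u i) * (v / N i)) L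
      (𝓝 (cubicCoeff τ * v ^ 3 / 3)) := by
  have hτ := h.pos
  have hN := h.tendsto_scale
  have hw : Tendsto (fun i => ‖v / (N i : ℂ)‖) L (𝓝 0) := by
    have : Tendsto (fun i => ‖v‖ * (N i)⁻¹) L (𝓝 0) := by
      simpa using (tendsto_inv_atTop_zero.comp hN).const_mul ‖v‖
    refine this.congr' ?_
    filter_upwards [hN.eventually_gt_atTop 0] with i hi
    rw [norm_div, Complex.norm_real, Real.norm_of_nonneg hi.le, div_eq_mul_inv]
  have hev : ∀ᶠ i in L, 0 < η i ∧ 0 < N i ∧ 1 / 2 < η i * N i ^ 3 ∧ 3 * τ / 4 < u i ∧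
      ‖v / (N i : ℂ)‖ < τ / 8 := by
    filter_upwards [h.step_pos, hN.eventually_gt_atTop 0,
      h.tendsto_step.eventually_const_lt (show (1 / 2 : ℝ) < 1 by norm_num),
      h.tendsto_time.eventually_const_lt (show 3 * τ / 4 < τ by linarith),
      hw.eventually_lt_const (show (0 : ℝ) < τ / 8 by linarith)] with i a b c d e
    exact ⟨a, b, c, d, e⟩
  rw [← tsum_cubicCoeff hτ]
  have key : Tendsto (fun i => ∑' n : ℕ, (weight (η i) (u i) n : ℂ) *
      (Complex.sinh (((n : ℂ) + 1) * (v / N i)) - ((n : ℂ) + 1) * (v / N i))) L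
      (𝓝 (∑' n : ℕ, ((((n : ℝ) + 1) * Real.exp (-(((n : ℝ) + 1) * τ / 2)) : ℝ) : ℂ) *
        (v ^ 3 / 3))) := by
    -- The factor 4 comes from ηN³ > 1/2, the rate τ/4 from u/2 - ‖v/N‖ > 3τ/8 - τ/8.
    refine tendsto_tsum_of_dominated_convergence
      (bound := fun n : ℕ => 4 * ‖v‖ ^ 3 * (((n : ℝ) + 1) * Real.exp (-(((n : ℝ) + 1) * (τ / 4)))))
      ((summable_succ_mul_exp (by linarith)).mul_left _) (fun n => ?_) ?_
    · have hk : (n : ℝ) + 1 ≠ 0 := by positivity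
      have hkc : (n : ℂ) + 1 ≠ 0 := by exact_mod_cast hk
      have a1 := tendsto_sinh_cubic hN (((n : ℂ) + 1) * v)
      have a2 := h.tendsto_sinh_step ((n : ℝ) + 1)
      have a3 : Tendsto (fun i => Real.exp (-(((n : ℝ) + 1) * u i / 2)) /
          (((n : ℝ) + 1) * (N i ^ 3 * Real.sinh (((n : ℝ) + 1) * η i / 2)))) L
          (𝓝 (Real.exp (-(((n : ℝ) + 1) * τ / 2)) / (((n : ℝ) + 1) * (((n : ℝ) + 1) / 2)))) := by
        refine Tendsto.div ?_ (a2.const_mul _) (by positivity)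
        exact (Real.continuous_exp.tendsto _).comp
          (((h.tendsto_time.const_mul _).div_const 2).neg)
      have a4 := ((Complex.continuous_ofReal.tendsto _).comp a3).mul a1
      have e : (((Real.exp (-(((n : ℝ) + 1) * τ / 2)) / (((n : ℝ) + 1) * (((n : ℝ) + 1) / 2)) : ℝ)) : ℂ) *
          ((((n : ℂ) + 1) * v) ^ 3 / 6) =
          ((((n : ℝ) + 1) * Real.exp (-(((n : ℝ) + 1) * τ / 2)) : ℝ) : ℂ) * (v ^ 3 / 3) := by
        push_cast; field_simp; ring
      rw [e] at a4
      refine a4.congr' ?_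
      filter_upwards [hev] with i hi
      have hNc : (N i : ℂ) ≠ 0 := by exact_mod_cast hi.2.1.ne'
      have hs : Real.sinh (((n : ℝ) + 1) * η i / 2) ≠ 0 :=
        (Real.sinh_pos_iff.2 (by have := hi.1; positivity)).ne'
      have hsc : ((Real.sinh (((n : ℝ) + 1) * η i / 2) : ℝ) : ℂ) ≠ 0 := by exact_mod_cast hs
      rw [Function.comp_apply, weight, mul_div_assoc]
      rw [Complex.ofReal_div, Complex.ofReal_div, Complex.ofReal_mul, Complex.ofReal_mul,
        Complex.ofReal_mul, Complex.ofReal_pow]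
      have hkc' : (((n : ℝ) + 1 : ℝ) : ℂ) ≠ 0 := by exact_mod_cast hk
      field_simp
    · filter_upwards [hev] with i hi n
      obtain ⟨h1, h2, h3, h4, h5⟩ := hi
      refine (norm_cubic_term_le h1 (u i) (v / N i) n).trans ?_
      have hz : ‖v / (N i : ℂ)‖ = ‖v‖ / N i := by
        rw [norm_div, Complex.norm_real, Real.norm_of_nonneg h2.le]
      have b1 : 2 * ‖v / (N i : ℂ)‖ ^ 3 / η i ≤ 4 * ‖v‖ ^ 3 := by
        rw [hz, div_pow, div_le_iff₀ h1, ← mul_div_assoc, div_le_iff₀ (by positivity)]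
        have : 0 ≤ ‖v‖ ^ 3 := by positivity
        nlinarith
      gcongr
      linarith
  refine key.congr' ?_
  filter_upwards [hev] with i hi
  refine (action_sub_slope hi.1 ?_).symm
  have := (Complex.abs_re_le_norm (v / (N i : ℂ)))
  linarith [hi.2.2.2.1, hi.2.2.2.2]

/-- Rescaled integral representation of the wave function. -/
theorem scale_mul_wave {n : ℝ} (hn : 0 < n) (η u σ : ℝ) (x : ℤ) :
    (n : ℂ) * wave η u (σ / n) x = (2 * (Real.pi : ℂ))⁻¹ * ∫ y : ℝ,
      (Ioc (-(Real.pi * n)) (Real.pi * n)).indicator (fun y : ℝ =>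
        Complex.exp (action η u (((σ : ℂ) + y * Complex.I) / n) -
          x * (((σ : ℂ) + y * Complex.I) / n))) y := by
  have hc : (n : ℂ) ≠ 0 := by exact_mod_cast hn.ne'
  rw [integral_indicator measurableSet_Ioc, wave, mul_left_comm,
    ← intervalIntegral.integral_of_le (by nlinarith [Real.pi_pos])]
  congr 1
  have := intervalIntegral.integral_comp_div (a := -(Real.pi * n)) (b := Real.pi * n)
    (fun θ : ℝ => Complex.exp (action η u ((σ / n : ℝ) + θ * Complex.I) -
      x * ((σ / n : ℝ) + θ * Complex.I))) hn.ne'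
  rw [neg_div, mul_div_cancel_right₀ _ hn.ne', Complex.real_smul] at this
  rw [← this]
  refine intervalIntegral.integral_congr fun y _ => ?_
  have e : ((σ : ℂ) + y * Complex.I) / n = ((σ / n : ℝ) : ℂ) + ((y / n : ℝ) : ℂ) * Complex.I := by
    push_cast; ring
  simp only [e]

/-- Gaussian domination of the integrand of the wave function. -/
theorem EdgeRegime.integrand_bound (h : EdgeRegime L N η u τ) {σ : ℝ} (hσ : 0 < σ) :
    ∃ C c : ℝ, 0 < C ∧ 0 < c ∧ ∀ᶠ i in L, σ / N i < u i / 2 ∧ ∀ (x : ℤ) (y : ℝ),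
      ‖(Ioc (-(Real.pi * N i)) (Real.pi * N i)).indicator (fun y : ℝ =>
        Complex.exp (action (η i) (u i) (((σ : ℂ) + y * Complex.I) / N i) -
          x * (((σ : ℂ) + y * Complex.I) / N i))) y‖ ≤
      C * Real.exp (-(σ * ((x - edgeSlope (η i) (u i)) / N i))) * Real.exp (-c * y ^ 2) := by
  have hτ := h.pos
  set M := ‖(cubicCoeff τ * (σ : ℂ) ^ 3 / 3 : ℂ)‖ + 1
  have h1 := (h.tendsto_action (σ : ℂ)).norm.eventually_lt_const (lt_add_one _)
  have h2 : Tendsto (fun i => σ / N i) L (𝓝 0) := h.tendsto_scale.const_div_atTop σ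
  have h3 := (h.tendsto_sinh_step 1).eventually_lt_const (show (1 / 2 : ℝ) < 1 by norm_num)
  -- M bounds the action minus its linear part at the real point σ/N. The Gaussian rate comes from
  -- the first weight, using N³ sinh(η/2) < 1 and u < 2τ.
  refine ⟨Real.exp M, Real.exp (-τ) * σ * (2 / Real.pi ^ 2), Real.exp_pos _,
    by have := Real.pi_pos; positivity, ?_⟩
  filter_upwards [h1, h2.eventually_lt_const (show (0 : ℝ) < τ / 4 by linarith), h3, h.step_pos,
    h.tendsto_scale.eventually_gt_atTop 0,
    h.tendsto_time.eventually_const_lt (show 3 * τ / 4 < τ by linarith),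
    h.tendsto_time.eventually_lt_const (show τ < 2 * τ by linarith)] with i b1 b2 b3 b4 b5 b6 b7
  have b8 : σ / N i < u i / 2 := by linarith
  refine ⟨b8, fun x y => ?_⟩
  by_cases hy : y ∈ Ioc (-(Real.pi * N i)) (Real.pi * N i)
  swap
  · rw [indicator_of_notMem hy, norm_zero]; positivity
  rw [indicator_of_mem hy, Complex.norm_exp, ← Real.exp_add, ← Real.exp_add]
  refine Real.exp_le_exp.2 ?_
  have hNc : (N i : ℂ) ≠ 0 := by exact_mod_cast b5.ne'
  have e : ((σ : ℂ) + y * Complex.I) / N i =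
      ((σ / N i : ℝ) : ℂ) + ((y / N i : ℝ) : ℂ) * Complex.I := by push_cast; ring
  have hθ : |y / N i| ≤ Real.pi := by
    rw [abs_div, abs_of_pos b5, div_le_iff₀ b5, abs_le]
    exact ⟨hy.1.le, hy.2⟩
  have c1 := action_re_le (u := u i) b4 (by positivity : 0 ≤ σ / N i) b8 hθ
  have c2 : (action (η i) (u i) ((σ / N i : ℝ) : ℂ)).re - edgeSlope (η i) (u i) * (σ / N i) ≤ M := by
    have := (Complex.re_le_norm _).trans b1.le
    have e2 : (edgeSlope (η i) (u i) : ℂ) * ((σ : ℂ) / N i) =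
      ((edgeSlope (η i) (u i) * (σ / N i) : ℝ) : ℂ) := by push_cast; ring
    rw [Complex.sub_re, e2, Complex.ofReal_re] at this
    rw [Complex.ofReal_div]
    exact this
  have c3 : Real.exp (-τ) * σ * (2 / Real.pi ^ 2) * y ^ 2 ≤
      weight (η i) (u i) 0 * (σ / N i * (2 / Real.pi ^ 2 * (y / N i) ^ 2)) := by
    rw [one_mul] at b3
    have hs : 0 < Real.sinh (η i / 2) := Real.sinh_pos_iff.2 (by linarith)
    have : weight (η i) (u i) 0 * (σ / N i * (2 / Real.pi ^ 2 * (y / N i) ^ 2)) =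
        Real.exp (-(u i / 2)) / (N i ^ 3 * Real.sinh (η i / 2)) * (σ * (2 / Real.pi ^ 2) * y ^ 2) := by
      rw [weight]
      simp only [Nat.cast_zero, zero_add, one_mul]
      field_simp
    rw [this, mul_assoc, mul_assoc, ← mul_assoc σ]
    refine mul_le_mul_of_nonneg_right ?_ (by positivity)
    rw [le_div_iff₀ (by positivity)]
    calc _ ≤ Real.exp (-τ) * 1 := by gcongr
      _ ≤ _ := by rw [mul_one]; exact Real.exp_le_exp.2 (by linarith)
  rw [e, Complex.sub_re]
  have e3 : ((x : ℂ) * (((σ / N i : ℝ) : ℂ) + ((y / N i : ℝ) : ℂ) * Complex.I)).re =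
      x * (σ / N i) := by
    simp
  rw [e3]
  have e4 : -(σ * ((x - edgeSlope (η i) (u i)) / N i)) =
    edgeSlope (η i) (u i) * (σ / N i) - x * (σ / N i) := by ring
  rw [e4]
  linarith

/-- Exponential bounds for the rescaled wave functions. -/
theorem EdgeRegime.wave_bound (h : EdgeRegime L N η u τ) {σ : ℝ} (hσ : 0 < σ) :
    ∃ C : ℝ, 0 < C ∧ ∀ᶠ i in L, ∀ x : ℤ,
      ‖(N i : ℂ) * wave (η i) (u i) (σ / N i) x‖ ≤
        C * Real.exp (-(σ * ((x - edgeSlope (η i) (u i)) / N i))) := by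
  obtain ⟨C, c, hC, hc, hb⟩ := h.integrand_bound hσ
  have hg : 0 < ∫ y : ℝ, Real.exp (-c * y ^ 2) := by
    rw [integral_gaussian]; have := Real.pi_pos; positivity
  refine ⟨(2 * Real.pi)⁻¹ * C * ∫ y : ℝ, Real.exp (-c * y ^ 2),
    by have := Real.pi_pos; positivity, ?_⟩
  filter_upwards [hb, h.tendsto_scale.eventually_gt_atTop 0] with i hi hn x
  rw [scale_mul_wave hn, norm_mul]
  have e : ‖(2 * (Real.pi : ℂ))⁻¹‖ = (2 * Real.pi)⁻¹ := by
    rw [norm_inv, norm_mul, Complex.norm_ofNat, Complex.norm_real,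
      Real.norm_of_nonneg Real.pi_pos.le]
  have := norm_integral_le_of_norm_le ((integrable_exp_neg_mul_sq hc).const_mul
    (C * Real.exp (-(σ * ((x - edgeSlope (η i) (u i)) / N i)))))
    (Eventually.of_forall (hi.2 x))
  rw [integral_const_mul] at this
  rw [e]
  calc _ ≤ (2 * Real.pi)⁻¹ * _ := mul_le_mul_of_nonneg_left this (by have := Real.pi_pos; positivity)
    _ = _ := by ring

/-- The scaling limit of the wave functions. -/
theorem EdgeRegime.tendsto_wave [L.IsCountablyGenerated] (h : EdgeRegime L N η u τ) {σ : ℝ}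
    (hσ : 0 < σ) {x : ι → ℤ} {ξ : ℝ}
    (hx : Tendsto (fun i => (x i - edgeSlope (η i) (u i)) / N i) L (𝓝 ξ)) :
    Tendsto (fun i => (N i : ℂ) * wave (η i) (u i) (σ / N i) (x i)) L
      (𝓝 (cubicLine (cubicCoeff τ) σ ξ)) := by
  obtain ⟨C, c, hC, hc, hb⟩ := h.integrand_bound hσ
  have hN := h.tendsto_scale
  have key : Tendsto (fun i => ∫ y : ℝ,
      (Ioc (-(Real.pi * N i)) (Real.pi * N i)).indicator (fun y : ℝ =>
        Complex.exp (action (η i) (u i) (((σ : ℂ) + y * Complex.I) / N i) -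
          x i * (((σ : ℂ) + y * Complex.I) / N i))) y) L
      (𝓝 (∫ y : ℝ, Complex.exp (cubicCoeff τ * (σ + y * Complex.I) ^ 3 / 3 -
        ξ * (σ + y * Complex.I)))) := by
    refine tendsto_integral_filter_of_dominated_convergence
      (fun y => C * Real.exp (σ * (|ξ| + 1)) * Real.exp (-c * y ^ 2)) ?_ ?_
      ((integrable_exp_neg_mul_sq hc).const_mul _) (Eventually.of_forall fun y => ?_)
    · filter_upwards [hb, h.step_pos, hN.eventually_gt_atTop 0] with i hi he hn
      refine (Continuous.aestronglyMeasurable ?_).indicator measurableSet_Ioc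
      have hcont := continuous_action (u := u i) (σ := σ / N i) he
        (by rw [abs_of_pos (by positivity)]; exact hi.1)
      have e : ∀ y : ℝ, ((σ : ℂ) + y * Complex.I) / N i =
          ((σ / N i : ℝ) : ℂ) + ((y / N i : ℝ) : ℂ) * Complex.I := fun y => by
        push_cast; ring
      simp only [e]
      exact Complex.continuous_exp.comp
        ((hcont.comp (continuous_id.div_const _)).sub (by fun_prop))
    · filter_upwards [hb, hx.abs.eventually_lt_const (lt_add_one _)] with i hi hxi
      refine Eventually.of_forall fun y => (hi.2 (x i) y).trans ?_
      gcongr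
      have := neg_abs_le ((x i - edgeSlope (η i) (u i)) / N i)
      nlinarith
    · have h1 := h.tendsto_action (σ + y * Complex.I)
      have h2 := ((Complex.continuous_ofReal.tendsto _).comp hx).mul_const
        ((σ : ℂ) + y * Complex.I)
      have h3 := (Complex.continuous_exp.tendsto _).comp (h1.sub h2)
      refine h3.congr' ?_
      -- For fixed y the integration window eventually contains y, so the indicator disappears in
      -- the limit.
      filter_upwards [hN.eventually_gt_atTop 0, hN.eventually_gt_atTop (|y|)] with i hn hny
      have hy : y ∈ Ioc (-(Real.pi * N i)) (Real.pi * N i) := by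
        have h3 := Real.pi_gt_three
        have := abs_lt.1 hny
        constructor <;> nlinarith
      rw [indicator_of_mem hy, Function.comp_apply, Function.comp_apply]
      congr 1
      push_cast
      ring
  have := key.const_mul (2 * (Real.pi : ℂ))⁻¹
  refine this.congr' ?_
  filter_upwards [hN.eventually_gt_atTop 0] with i hn
  rw [scale_mul_wave hn]

end

/-! ### The Airy function as an integral along a vertical line -/

/-- The integrand of the Airy integral. -/
def airyExp (x : ℝ) (z : ℂ) : ℂ := Complex.exp (z ^ 3 / 3 - x * z)

theorem norm_airyExp (x a b : ℝ) :
    ‖airyExp x (a + b * Complex.I)‖ = Real.exp (a ^ 3 / 3 - a * b ^ 2 - x * a) := by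
  rw [airyExp, Complex.norm_exp]
  congr 1
  have : ((a : ℂ) + b * Complex.I) ^ 3 / 3 - x * (a + b * Complex.I) =
      ((a ^ 3 / 3 - a * b ^ 2 - x * a : ℝ) : ℂ) + ((a ^ 2 * b - b ^ 3 / 3 - x * b : ℝ) : ℂ) *
        Complex.I := by
    have hI : Complex.I ^ 2 = -1 := Complex.I_sq
    have hI3 : Complex.I ^ 3 = -Complex.I := by rw [pow_succ, hI]; ring
    push_cast
    ring_nf
    rw [hI, hI3]
    ring
  rw [this, Complex.add_re, Complex.re_ofReal_mul, Complex.ofReal_re, Complex.I_re, mul_zero,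
    add_zero]

theorem exists_primitive_airyExp (x : ℝ) : ∃ P : ℂ → ℂ, ∀ z, HasDerivAt P (airyExp x z) z := by
  have hd : Differentiable ℂ (airyExp x) := by unfold airyExp; fun_prop
  obtain ⟨P, hP⟩ := hd.isExactOn_univ
  exact ⟨P, fun z => hP z (mem_univ z)⟩

theorem continuous_airyExp (x : ℝ) : Continuous (airyExp x) := by unfold airyExp; fun_prop

/-- Horizontal displacements of the endpoint are negligible. -/
theorem tendsto_primitive_horizontal {x : ℝ} {P : ℂ → ℂ} (hP : ∀ z, HasDerivAt P (airyExp x z) z)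
    {σ : ℝ} (hσ : 0 < σ) {s : ℝ} (hs : s ^ 2 = 3 / 4) :
    Tendsto (fun R : ℝ => P (((R / 2 : ℝ) : ℂ) + ((s * R : ℝ) : ℂ) * Complex.I) -
      P (σ + ((s * R : ℝ) : ℂ) * Complex.I)) atTop (𝓝 0) := by
  have hb : Tendsto (fun R : ℝ => Real.exp (σ * |x|) * (R * Real.exp (-(2 * σ / 3) * R)))
      atTop (𝓝 0) := by
    have h := Real.tendsto_pow_mul_exp_neg_atTop_nhds_zero 1
    have h2 : Tendsto (fun R : ℝ => (2 * σ / 3) * R) atTop atTop :=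
      tendsto_id.const_mul_atTop (by positivity)
    have h3 := (h.comp h2).const_mul (Real.exp (σ * |x|) * (2 * σ / 3)⁻¹)
    rw [mul_zero] at h3
    refine h3.congr fun R => ?_
    simp only [Function.comp, pow_one]
    field_simp
  refine squeeze_zero_norm' ?_ hb
  filter_upwards [eventually_ge_atTop (2 * σ), eventually_ge_atTop 1,
    eventually_ge_atTop (2 * |x|)] with R h1 h2 h3
  have hseg : ∀ z ∈ segment ℝ ((σ : ℂ) + ((s * R : ℝ) : ℂ) * Complex.I)
      (((R / 2 : ℝ) : ℂ) + ((s * R : ℝ) : ℂ) * Complex.I),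
      ‖airyExp x z‖ ≤ Real.exp (σ * |x|) * Real.exp (-(2 * σ / 3) * R) := by
    rintro z ⟨a, b, ha, hb', hab, rfl⟩
    have e : a • ((σ : ℂ) + ((s * R : ℝ) : ℂ) * Complex.I) +
        b • (((R / 2 : ℝ) : ℂ) + ((s * R : ℝ) : ℂ) * Complex.I) =
        ((a * σ + b * (R / 2) : ℝ) : ℂ) + ((s * R : ℝ) : ℂ) * Complex.I := by
      have : (a : ℂ) + b = 1 := by exact_mod_cast hab
      rw [Complex.real_smul, Complex.real_smul]
      push_cast
      linear_combination ((s : ℂ) * R * Complex.I) * this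
    rw [e, norm_airyExp, ← Real.exp_add]
    refine Real.exp_le_exp.2 ?_
    set p := a * σ + b * (R / 2)
    have hp1 : σ ≤ p := by
      have : σ = a * σ + b * σ := by rw [← add_mul, hab, one_mul]
      have : b * σ ≤ b * (R / 2) := by gcongr; linarith
      simp only [p]; linarith
    have hp2 : p ≤ R / 2 := by
      have : R / 2 = a * (R / 2) + b * (R / 2) := by rw [← add_mul, hab, one_mul]
      have : a * σ ≤ a * (R / 2) := by gcongr; linarith
      simp only [p]; linarith
    have hp0 : 0 < p := by linarith
    have hR2 : R ≤ R ^ 2 := by nlinarith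
    have hsq : p ^ 2 ≤ R ^ 2 / 4 := by nlinarith
    have hc : p ^ 3 / 3 - p * (s * R) ^ 2 - x * p = p * (p ^ 2 / 3 - 3 / 4 * R ^ 2 - x) := by
      rw [mul_pow, hs]; ring
    rw [hc]
    have hx := neg_abs_le x
    have h4 : p ^ 2 / 3 - 3 / 4 * R ^ 2 - x ≤ |x| - 2 / 3 * R := by nlinarith
    have h5 : |x| - 2 / 3 * R ≤ 0 := by linarith [abs_nonneg x]
    nlinarith [mul_le_mul_of_nonneg_left h4 hp0.le, mul_le_mul_of_nonpos_right hp1 h5]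
  have h := (convex_segment _ _).norm_image_sub_le_of_norm_hasDerivWithin_le
    (fun z _ => (hP z).hasDerivWithinAt) hseg (left_mem_segment ℝ _ _) (right_mem_segment ℝ _ _)
  refine h.trans ?_
  have hlen : ‖(((R / 2 : ℝ) : ℂ) + ((s * R : ℝ) : ℂ) * Complex.I) -
      ((σ : ℂ) + ((s * R : ℝ) : ℂ) * Complex.I)‖ ≤ R := by
    rw [add_sub_add_right_eq_sub, ← Complex.ofReal_sub, Complex.norm_real, Real.norm_eq_abs,
      abs_of_nonneg (by linarith)]
    linarith
  calc _ ≤ Real.exp (σ * |x|) * Real.exp (-(2 * σ / 3) * R) * R := by gcongr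
    _ = _ := by ring

/-- On the directions 1/2 ± i√3/2 the cube of pw is -p³, so the integrand decays superexponentially
and the ray integral is the limiting increment of a primitive. -/
theorem tendsto_primitive_ray {x : ℝ} {P : ℂ → ℂ} (hP : ∀ z, HasDerivAt P (airyExp x z) z)
    {s : ℝ} (hs : s ^ 2 = 3 / 4) :
    Tendsto (fun R : ℝ => P (((R / 2 : ℝ) : ℂ) + ((s * R : ℝ) : ℂ) * Complex.I) - P 0) atTop
      (𝓝 (airyRay ((1 / 2 : ℝ) + s * Complex.I) x)) := by
  set w : ℂ := (1 / 2 : ℝ) + s * Complex.I with hw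
  have hpw : ∀ p : ℝ, (p : ℂ) * w = ((p / 2 : ℝ) : ℂ) + ((s * p : ℝ) : ℂ) * Complex.I := by
    intro p; rw [hw]; push_cast; ring
  have hcont : Continuous fun p : ℝ => airyExp x (p * w) * w :=
    ((continuous_airyExp x).comp (by fun_prop)).mul continuous_const
  have hint : IntegrableOn (fun p : ℝ => airyExp x (p * w) * w) (Ioi 0) := by
    -- The summand |x|/2 compensates the linear term of the exponent, and the extra 1 leaves the
    -- majorant e^{-p}.
    set b := |x| / 2 + 1
    have hb : 1 ≤ b := by have := abs_nonneg x; simp only [b]; linarith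
    refine Integrable.mono' ((exp_neg_integrableOn_Ioi 0 one_pos).const_mul
      (Real.exp (3 * b ^ 2) * ‖w‖)) hcont.aestronglyMeasurable ?_
    refine (ae_restrict_iff' measurableSet_Ioi).2 (Eventually.of_forall fun p hp => ?_)
    have hp : 0 < p := hp
    rw [norm_mul, hpw, norm_airyExp, mul_right_comm, ← Real.exp_add]
    gcongr
    have e : (p / 2) ^ 3 / 3 - p / 2 * (s * p) ^ 2 - x * (p / 2) = -p ^ 3 / 3 - x * (p / 2) := by
      rw [mul_pow, hs]; ring
    rw [e]
    have h1 : -x * (p / 2) ≤ |x| * (p / 2) := by gcongr; exact neg_le_abs x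
    have h2 : b * p ≤ p ^ 3 / 3 + 3 * b ^ 2 := by
      rcases le_total p (3 * b) with h | h
      · have : 0 ≤ p ^ 3 / 3 := by positivity
        nlinarith
      · have : 3 * b ≤ p ^ 2 := by nlinarith
        nlinarith [mul_le_mul_of_nonneg_left this hp.le]
    have h3 : b * p = |x| * (p / 2) + p := by simp only [b]; ring
    linarith
  have h := intervalIntegral_tendsto_integral_Ioi 0 hint tendsto_id
  have e : airyRay w x = ∫ p in Ioi (0 : ℝ), airyExp x (p * w) * w := rfl
  rw [e]
  refine h.congr fun R => ?_
  have hd : ∀ p ∈ uIcc (0 : ℝ) R, HasDerivAt (fun p : ℝ => P (p * w)) (airyExp x (p * w) * w) p := by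
    intro p _
    have h1 : HasDerivAt (fun p : ℝ => (p : ℂ) * w) w p := by
      simpa using (Complex.ofRealCLM.hasDerivAt (x := p)).mul_const w
    exact (hP _).comp p h1
  rw [id, intervalIntegral.integral_eq_sub_of_hasDerivAt hd (hcont.intervalIntegrable _ _), hpw]
  simp

theorem integrable_airyExp_line (x : ℝ) {σ : ℝ} (hσ : 0 < σ) :
    Integrable fun y : ℝ => airyExp x (σ + y * Complex.I) := by
  refine Integrable.mono' ((integrable_exp_neg_mul_sq hσ).const_mul
    (Real.exp (σ ^ 3 / 3 - x * σ)))
    ((continuous_airyExp x).comp (by fun_prop)).aestronglyMeasurable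
    (Eventually.of_forall fun y => ?_)
  rw [norm_airyExp, ← Real.exp_add]
  apply le_of_eq; congr 1; ring

theorem tendsto_primitive_line {x : ℝ} {P : ℂ → ℂ} (hP : ∀ z, HasDerivAt P (airyExp x z) z)
    {σ : ℝ} (hσ : 0 < σ) :
    Tendsto (fun R : ℝ => P (σ + (R : ℂ) * Complex.I) - P (σ + ((-R : ℝ) : ℂ) * Complex.I)) atTop
      (𝓝 ((∫ y : ℝ, airyExp x (σ + y * Complex.I)) * Complex.I)) := by
  have h := (intervalIntegral_tendsto_integral (integrable_airyExp_line x hσ)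
    tendsto_neg_atTop_atBot tendsto_id).mul_const Complex.I
  refine h.congr fun R => ?_
  have hd : ∀ p ∈ uIcc (-R) R, HasDerivAt (fun p : ℝ => P (σ + p * Complex.I))
      (airyExp x (σ + p * Complex.I) * Complex.I) p := by
    intro p _
    have h1 : HasDerivAt (fun p : ℝ => (σ : ℂ) + (p : ℂ) * Complex.I) Complex.I p := by
      simpa using ((Complex.ofRealCLM.hasDerivAt (x := p)).mul_const Complex.I).const_add (σ : ℂ)
    exact (hP _).comp p h1
  rw [id, ← intervalIntegral.integral_mul_const,
    intervalIntegral.integral_eq_sub_of_hasDerivAt hd]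
  refine Continuous.intervalIntegrable ?_ _ _
  exact ((continuous_airyExp x).comp (by fun_prop)).mul continuous_const

theorem cubicLine_one (x σ : ℝ) :
    cubicLine 1 σ x = (2 * (Real.pi : ℂ))⁻¹ * ∫ y : ℝ, airyExp x (σ + y * Complex.I) := by
  unfold cubicLine airyExp
  simp

/-- The integrand is entire and has a primitive P. The rays and the vertical line give increments of
P whose far endpoints differ by horizontal displacements, negligible at infinity; the two
contributions of P(0) cancel. -/
theorem cubicLine_one_eq_rays (x : ℝ) {σ : ℝ} (hσ : 0 < σ) :
    cubicLine 1 σ x = (airyRay (Complex.exp ((Real.pi / 3 : ℝ) * Complex.I)) x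
      - airyRay (Complex.exp ((-(Real.pi / 3) : ℝ) * Complex.I)) x)
      / (2 * (Real.pi : ℂ) * Complex.I) := by
  obtain ⟨P, hP⟩ := exists_primitive_airyExp x
  set s : ℝ := Real.sqrt 3 / 2 with hs
  have hs2 : s ^ 2 = 3 / 4 := by rw [hs, div_pow, Real.sq_sqrt (by norm_num)]; norm_num
  have hs2' : (-s) ^ 2 = 3 / 4 := by rw [neg_sq, hs2]
  have hs0 : 0 < s := by positivity
  have e1 : Complex.exp ((Real.pi / 3 : ℝ) * Complex.I) = (1 / 2 : ℝ) + s * Complex.I := by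
    rw [Complex.exp_mul_I, ← Complex.ofReal_cos, ← Complex.ofReal_sin, Real.cos_pi_div_three,
      Real.sin_pi_div_three]
  have e2 : Complex.exp ((-(Real.pi / 3) : ℝ) * Complex.I) =
      (1 / 2 : ℝ) + ((-s : ℝ) : ℂ) * Complex.I := by
    rw [Complex.exp_mul_I, ← Complex.ofReal_cos, ← Complex.ofReal_sin, Real.cos_neg, Real.sin_neg,
      Real.cos_pi_div_three, Real.sin_pi_div_three]
  have t1 := (tendsto_primitive_ray hP hs2).sub (tendsto_primitive_horizontal hP hσ hs2)
  have t2 := (tendsto_primitive_ray hP hs2').sub (tendsto_primitive_horizontal hP hσ hs2')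
  have t3 := t1.sub t2
  have t4 := (tendsto_primitive_line hP hσ).comp (tendsto_id.const_mul_atTop hs0)
  have h := tendsto_nhds_unique (t4.congr fun R => ?_) t3
  · rw [e1, e2, cubicLine_one]
    have hpi : (Real.pi : ℂ) ≠ 0 := by exact_mod_cast Real.pi_ne_zero
    rw [sub_zero, sub_zero] at h
    rw [← h]
    generalize (∫ y : ℝ, airyExp x (σ + y * Complex.I)) = J
    field_simp
  · simp only [Function.comp, id]
    rw [show -(s * R) = -s * R by ring]
    ring

theorem conj_cubicLine_one (x σ : ℝ) :
    (starRingEnd ℂ) (cubicLine 1 σ x) = cubicLine 1 σ x := by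
  rw [cubicLine_one, map_mul, ← integral_conj]
  congr 1
  · simp [map_ofNat]
  · rw [← integral_neg_eq_self]
    refine integral_congr_ae (Eventually.of_forall fun y => ?_)
    simp only [airyExp]
    rw [← Complex.exp_conj]
    congr 1
    simp [map_ofNat]

/-- Rescaling v by κ normalizes the cubic coefficient. The value is real, by conjugation and y ↦ -y,
so the real part in the definition of `Ai` loses nothing. -/
theorem cubicLine_eq_Ai {κ σ : ℝ} (hκ : 0 < κ) (hσ : 0 < σ) (ξ : ℝ) :
    cubicLine (κ ^ 3) σ ξ = ((κ⁻¹ * Ai (ξ / κ) : ℝ) : ℂ) := by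
  have h1 : cubicLine (κ ^ 3) σ ξ = (κ : ℂ)⁻¹ * cubicLine 1 (κ * σ) (ξ / κ) := by
    have hc : (κ : ℂ) ≠ 0 := by exact_mod_cast hκ.ne'
    have := Measure.integral_comp_mul_left
      (fun y : ℝ => airyExp (ξ / κ) (((κ * σ : ℝ) : ℂ) + y * Complex.I)) κ
    rw [abs_of_pos (inv_pos.2 hκ), Complex.real_smul] at this
    rw [cubicLine_one, mul_left_comm, ← Complex.ofReal_inv, ← this, cubicLine]
    congr 2
    funext y
    rw [airyExp]
    congr 1
    push_cast
    field_simp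
  have h2 := (Complex.conj_eq_iff_re.1 (conj_cubicLine_one (ξ / κ) (κ * σ))).symm
  rw [h1, h2, cubicLine_one_eq_rays _ (mul_pos hκ hσ), Complex.ofReal_mul, Complex.ofReal_inv]
  rfl

/-! ### The limiting border -/

theorem one_sub_exp_pos {τ : ℝ} (hτ : 0 < τ) : 0 < 1 - Real.exp (-τ / 2) := by
  have := Real.exp_lt_one_iff.2 (show -τ / 2 < 0 by linarith)
  linarith

theorem hasDerivAt_exp_half (τ : ℝ) :
    HasDerivAt (fun τ : ℝ => Real.exp (-τ / 2)) (-(Real.exp (-τ / 2) / 2)) τ := by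
  have h : HasDerivAt (fun τ : ℝ => -τ / 2) (-1 / 2) τ := (hasDerivAt_id τ).neg.div_const 2
  exact h.exp.congr_deriv (by ring)

theorem hasDerivAt_border {τ : ℝ} (hτ : 0 < τ) :
    HasDerivAt border (-(Real.exp (-τ / 2) / (1 - Real.exp (-τ / 2)))) τ := by
  have h := (((hasDerivAt_exp_half τ).const_sub 1).log (one_sub_exp_pos hτ).ne').const_mul (-2)
  have := (one_sub_exp_pos hτ).ne'
  refine h.congr_deriv ?_
  field_simp

theorem deriv_border_eventuallyEq {τ : ℝ} (hτ : 0 < τ) :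
    deriv border =ᶠ[𝓝 τ] fun τ => -(Real.exp (-τ / 2) / (1 - Real.exp (-τ / 2))) := by
  filter_upwards [lt_mem_nhds hτ] with y hy
  exact (hasDerivAt_border hy).deriv

theorem hasDerivAt_deriv_border {τ : ℝ} (hτ : 0 < τ) :
    HasDerivAt (deriv border) (cubicCoeff τ / 2) τ := by
  refine HasDerivAt.congr_of_eventuallyEq ?_ (deriv_border_eventuallyEq hτ)
  have h := ((hasDerivAt_exp_half τ).div ((hasDerivAt_exp_half τ).const_sub 1)
    (one_sub_exp_pos hτ).ne').neg
  refine h.congr_deriv ?_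
  have := (one_sub_exp_pos hτ).ne'
  rw [cubicCoeff]
  field_simp
  ring

theorem cubicCoeff_pos {τ : ℝ} (hτ : 0 < τ) : 0 < cubicCoeff τ := by
  have := one_sub_exp_pos hτ
  unfold cubicCoeff; positivity

theorem kappa_eq {τ : ℝ} (hτ : 0 < τ) : kappa τ = cubicCoeff τ ^ (1 / 3 : ℝ) := by
  rw [kappa, (hasDerivAt_deriv_border hτ).deriv, mul_div_cancel₀ _ two_ne_zero]

theorem kappa_pos {τ : ℝ} (hτ : 0 < τ) : 0 < kappa τ := by
  rw [kappa_eq hτ]; exact Real.rpow_pos_of_pos (cubicCoeff_pos hτ) _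

theorem kappa_pow {τ : ℝ} (hτ : 0 < τ) : kappa τ ^ 3 = cubicCoeff τ := by
  rw [kappa_eq hτ, ← Real.rpow_natCast, ← Real.rpow_mul (cubicCoeff_pos hτ).le]
  norm_num

/-- Second-order Taylor expansion with little-o remainder. -/
theorem isLittleO_taylor_two {f f' : ℝ → ℝ} {x f'' : ℝ}
    (hf : ∀ᶠ y in 𝓝 x, HasDerivAt f (f' y) y) (hf' : HasDerivAt f' f'' x) :
    (fun y => f y - f x - f' x * (y - x) - f'' / 2 * (y - x) ^ 2) =o[𝓝 x]
      fun y => (y - x) ^ 2 := by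
  rw [Asymptotics.isLittleO_iff]
  intro ε hε
  have h1 := (hasDerivAt_iff_isLittleO.1 hf').def hε
  obtain ⟨d, hd, hball⟩ := Metric.eventually_nhds_iff_ball.1 (hf.and h1)
  filter_upwards [Metric.ball_mem_nhds x hd] with y hy
  have hsub : ∀ z ∈ uIcc x y, z ∈ Metric.ball x d ∧ |z - x| ≤ |y - x| := by
    intro z hz
    have := abs_sub_left_of_mem_uIcc hz
    exact ⟨by rw [Metric.mem_ball, Real.dist_eq] at *; linarith, this⟩
  have h := (convex_uIcc x y).norm_image_sub_le_of_norm_hasDerivWithin_le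
    (f := fun y => f y - f' x * (y - x) - f'' / 2 * (y - x) ^ 2)
    (f' := fun y => f' y - f' x - (y - x) * f'') (C := ε * |y - x|)
    (fun z hz => by
      have a := (hball z (hsub z hz).1).1
      have b : HasDerivAt (fun y => y - x) 1 z := (hasDerivAt_id z).sub_const x
      have c := (a.sub (b.const_mul (f' x))).sub ((b.pow 2).const_mul (f'' / 2))
      refine (c.congr_deriv ?_).hasDerivWithinAt
      simp; ring)
    (fun z hz => by
      have a := (hball z (hsub z hz).1).2
      rw [Real.norm_eq_abs, smul_eq_mul, Real.norm_eq_abs] at a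
      exact a.trans (mul_le_mul_of_nonneg_left (hsub z hz).2 hε.le))
    left_mem_uIcc right_mem_uIcc
  have e : f y - f x - f' x * (y - x) - f'' / 2 * (y - x) ^ 2 =
      (f y - f' x * (y - x) - f'' / 2 * (y - x) ^ 2) -
        (f x - f' x * (x - x) - f'' / 2 * (x - x) ^ 2) := by ring
  rw [e]
  refine h.trans_eq ?_
  rw [norm_pow, Real.norm_eq_abs]; ring

/-! ### Asymptotics of the slope of the action -/

theorem inv_sub_inv_sinh_mem {y : ℝ} (hy : 0 < y) :
    0 ≤ 1 / y - 1 / Real.sinh y ∧ 1 / y - 1 / Real.sinh y ≤ 1 := by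
  have hs : 0 < Real.sinh y := Real.sinh_pos_iff.2 hy
  have h1 : y ≤ Real.sinh y := Real.self_le_sinh_iff.2 hy.le
  refine ⟨sub_nonneg.2 (one_div_le_one_div_of_le hy h1), ?_⟩
  rw [div_sub_div _ _ hy.ne' hs.ne', div_le_one (by positivity)]
  rcases le_or_gt 1 y with h | h
  · nlinarith
  · have h2 : Real.exp y * (1 - y) ≤ 1 := by
      have h3 := Real.add_one_le_exp (-y)
      have : Real.exp y * Real.exp (-y) = 1 := by rw [← Real.exp_add]; simp
      nlinarith [Real.exp_pos y]
    have h4 := Real.add_one_le_exp (-y)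
    rw [Real.sinh_eq]
    nlinarith

/-- Replacing sinh(kη/2) by kη/2 turns the slope into the logarithmic series of b_∞(u)/η. Since 1/y
- 1/sinh y lies in [0,1], each mode changes by at most its exponential factor, uniformly in η. -/
theorem abs_edgeSlope_sub_le {η u : ℝ} (hη : 0 < η) (hu : 0 < u) :
    |edgeSlope η u - border u / η| ≤ ∑' n : ℕ, Real.exp (-(((n : ℝ) + 1) * u / 2)) := by
  have ha := one_sub_exp_pos hu
  have hexp : ∀ n : ℕ, Real.exp (-u / 2) ^ (n + 1) = Real.exp (-(((n : ℝ) + 1) * u / 2)) := by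
    intro n; rw [← Real.exp_nat_mul]; congr 1; push_cast; ring
  have h1 := Real.hasSum_pow_div_log_of_abs_lt_one (x := Real.exp (-u / 2))
    (by rw [abs_of_pos (Real.exp_pos _)]; linarith)
  simp only [hexp] at h1
  have h2 : HasSum (fun n : ℕ => Real.exp (-(((n : ℝ) + 1) * u / 2)) *
      (1 / (((n : ℝ) + 1) * η / 2))) (border u / η) := by
    have := (h1.mul_left 2).div_const η
    have e : 2 * -Real.log (1 - Real.exp (-u / 2)) / η = border u / η := by rw [border]; ring
    rw [e] at this
    convert! this using 2 with n
    field_simp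
  have h3 : HasSum (fun n : ℕ => Real.exp (-(((n : ℝ) + 1) * u / 2)) *
      (1 / Real.sinh (((n : ℝ) + 1) * η / 2))) (edgeSlope η u) := by
    have := (summable_weight_mul hη hu).hasSum
    simp only [weight_mul] at this
    simpa only [mul_one_div, edgeSlope] using this
  have h4 := h2.sub h3
  have hy : ∀ n : ℕ, 0 < ((n : ℝ) + 1) * η / 2 := fun n => by positivity
  have hs : Summable fun n : ℕ => Real.exp (-(((n : ℝ) + 1) * u / 2)) := by
    have := (summable_nat_add_iff 1).2 (summable_geometric_of_lt_one (Real.exp_pos (-u / 2)).le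
      (by linarith))
    simpa only [hexp] using this
  rw [abs_sub_comm, ← h4.tsum_eq]
  rw [abs_of_nonneg]
  · refine h4.summable.tsum_le_tsum (fun n => ?_) hs
    rw [← mul_sub]
    exact mul_le_of_le_one_right (Real.exp_pos _).le (inv_sub_inv_sinh_mem (hy n)).2
  · refine tsum_nonneg fun n => ?_
    rw [← mul_sub]
    exact mul_nonneg (Real.exp_pos _).le (inv_sub_inv_sinh_mem (hy n)).1

/-! ### The edge scaling -/

/-- The rate `-ln q` for `q = 1 - 1/T`. -/
def rate (T : ℝ) : ℝ := -Real.log (1 - 1 / T)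

theorem exp_neg_rate {T : ℝ} (hT : 1 < T) : Real.exp (-rate T) = 1 - 1 / T := by
  rw [rate, neg_neg, Real.exp_log]
  rw [sub_pos, div_lt_one (by linarith)]; exact hT

theorem one_le_mul_rate {T : ℝ} (hT : 1 < T) : 1 ≤ T * rate T := by
  have hT0 : 0 < T := by linarith
  have h : 0 < 1 - 1 / T := by rw [sub_pos, div_lt_one hT0]; exact hT
  have h1 := Real.log_le_sub_one_of_pos h
  have : 1 / T ≤ rate T := by rw [rate]; linarith
  calc (1 : ℝ) = T * (1 / T) := by field_simp
    _ ≤ _ := by gcongr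

theorem mul_rate_le_one {T : ℝ} (hT : 1 < T) : (T - 1) * rate T ≤ 1 := by
  have hT0 : 0 < T := by linarith
  have hT1 : 0 < T - 1 := by linarith
  have h : 0 < 1 - 1 / T := by rw [sub_pos, div_lt_one hT0]; exact hT
  have h1 := Real.one_sub_inv_le_log_of_pos h
  have h2 : (1 - 1 / T)⁻¹ = 1 + 1 / (T - 1) := by
    have : 1 - 1 / T = (T - 1) / T := by field_simp
    rw [this, inv_div]; field_simp; ring
  rw [h2] at h1
  have : rate T ≤ 1 / (T - 1) := by rw [rate]; linarith
  calc (T - 1) * rate T ≤ (T - 1) * (1 / (T - 1)) := by gcongr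
    _ = 1 := by field_simp

theorem rate_pos {T : ℝ} (hT : 1 < T) : 0 < rate T := by
  have := one_le_mul_rate hT
  by_contra h
  nlinarith

theorem rpow_third_pow {T : ℝ} (hT : 0 ≤ T) : (T ^ (1 / 3 : ℝ)) ^ 3 = T := by
  rw [← Real.rpow_natCast, ← Real.rpow_mul hT]; norm_num

theorem rpow_third_sq {T : ℝ} (hT : 0 ≤ T) : (T ^ (1 / 3 : ℝ)) ^ 2 = T ^ (2 / 3 : ℝ) := by
  rw [← Real.rpow_natCast, ← Real.rpow_mul hT]; norm_num

section

variable {ι : Type*} {L : Filter ι} {T s r : ι → ℝ} {τ s₀ r₀ : ℝ}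

theorem tendsto_scale (hT : Tendsto T L atTop) : Tendsto (fun i => T i ^ (1 / 3 : ℝ)) L atTop :=
  (tendsto_rpow_atTop (by norm_num)).comp hT

/-- The error in replacing the rate by 1/T is of relative size N⁻³. Precision o(N⁻²) is what the
edge requires: an error in u is multiplied by T = N³ in the position and then divided by N. -/
theorem tendsto_rate (hT : Tendsto T L atTop) :
    Tendsto (fun i => (T i ^ (1 / 3 : ℝ)) ^ 2 * (rate (T i) * T i - 1)) L (𝓝 0) := by
  have hN := tendsto_scale hT
  have h2 : Tendsto (fun i => 2 * (T i ^ (1 / 3 : ℝ))⁻¹) L (𝓝 0) := by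
    simpa using (tendsto_inv_atTop_zero.comp hN).const_mul 2
  refine squeeze_zero' ?_ ?_ h2
  · filter_upwards [hT.eventually_gt_atTop 1] with i hi
    have := one_le_mul_rate hi
    exact mul_nonneg (by positivity) (by linarith)
  · filter_upwards [hT.eventually_gt_atTop 2] with i hi
    have h1 : 1 < T i := by linarith
    have h3 := mul_rate_le_one h1
    have hp := rate_pos h1
    have h4 : T i * (rate (T i) * T i - 1) ≤ 2 := by
      have : rate (T i) * T i - 1 ≤ rate (T i) := by linarith
      have h6 : T i * rate (T i) ≤ 2 := by nlinarith
      nlinarith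
    have hn : 0 < T i ^ (1 / 3 : ℝ) := by positivity
    rw [← div_eq_mul_inv, le_div_iff₀ hn]
    calc _ = (T i ^ (1 / 3 : ℝ)) ^ 3 * (rate (T i) * T i - 1) := by ring
      _ ≤ 2 := by rw [rpow_third_pow (by linarith)]; exact h4

theorem tendsto_rate_mul (hT : Tendsto T L atTop) : Tendsto (fun i => rate (T i) * T i) L (𝓝 1) := by
  have h := (tendsto_rate hT).mul ((tendsto_inv_atTop_zero.comp (tendsto_scale hT)).pow 2)
  have h2 := h.add_const 1
  simp only [Function.comp] at h2
  rw [zero_mul, zero_add] at h2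
  refine h2.congr' ?_
  filter_upwards [hT.eventually_gt_atTop 0] with i hi
  have hn : T i ^ (1 / 3 : ℝ) ≠ 0 := by positivity
  field_simp
  ring

/-- The rescaled time agrees with its linearization to the required order. -/
theorem tendsto_time_error (τ : ℝ) (hT : Tendsto T L atTop) (hs : Tendsto s L (𝓝 s₀)) :
    Tendsto (fun i => (T i ^ (1 / 3 : ℝ)) ^ 2 *
      (rate (T i) * edgeTime τ (T i) (s i) - τ - s i / T i ^ (1 / 3 : ℝ))) L (𝓝 0) := by
  have hN := tendsto_scale hT
  have hinv : Tendsto (fun i => (T i ^ (1 / 3 : ℝ))⁻¹) L (𝓝 0) := tendsto_inv_atTop_zero.comp hN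
  have a1 := (tendsto_rate hT).const_mul τ
  have a2 := ((tendsto_rate hT).mul hs).mul hinv
  have a3 : Tendsto (fun i => (T i ^ (1 / 3 : ℝ)) ^ 2 * rate (T i) *
      ((edgeTime τ (T i) (s i) : ℝ) - (τ * T i + s i * T i ^ (2 / 3 : ℝ)))) L (𝓝 0) := by
    have b : Tendsto (fun i => (T i ^ (1 / 3 : ℝ))⁻¹ * (rate (T i) * T i)) L (𝓝 0) := by
      simpa using hinv.mul (tendsto_rate_mul hT)
    refine squeeze_zero_norm' ?_ b
    filter_upwards [hT.eventually_gt_atTop 1] with i hi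
    have hp := rate_pos hi
    have hn : 0 < T i ^ (1 / 3 : ℝ) := by positivity
    have h1 : |(edgeTime τ (T i) (s i) : ℝ) - (τ * T i + s i * T i ^ (2 / 3 : ℝ))| ≤ 1 := by
      unfold edgeTime
      have h2 := Int.floor_le (τ * T i + s i * T i ^ (2 / 3 : ℝ))
      have h3 := Int.lt_floor_add_one (τ * T i + s i * T i ^ (2 / 3 : ℝ))
      rw [abs_le]; constructor <;> linarith
    rw [norm_mul, Real.norm_of_nonneg (by positivity), Real.norm_eq_abs]
    calc _ ≤ (T i ^ (1 / 3 : ℝ)) ^ 2 * rate (T i) * 1 := by gcongr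
      _ = (T i ^ (1 / 3 : ℝ))⁻¹ * (rate (T i) * (T i ^ (1 / 3 : ℝ)) ^ 3) := by field_simp
      _ = _ := by rw [rpow_third_pow (by linarith)]
  have h := (a1.add a2).add a3
  simp only [mul_zero, zero_mul, add_zero] at h
  refine h.congr' ?_
  filter_upwards [hT.eventually_gt_atTop 1] with i hi
  have hn : T i ^ (1 / 3 : ℝ) ≠ 0 := by positivity
  rw [← rpow_third_sq (by linarith)]
  generalize hNN : T i ^ (1 / 3 : ℝ) = n at *
  have hT3 : T i = n ^ 3 := by rw [← hNN, rpow_third_pow (by linarith)]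
  generalize rate (T i) = e
  generalize (edgeTime τ (T i) (s i) : ℝ) = t
  rw [hT3]
  field_simp
  ring

theorem tendsto_scaled_time (τ : ℝ) (hT : Tendsto T L atTop) (hs : Tendsto s L (𝓝 s₀)) :
    Tendsto (fun i => T i ^ (1 / 3 : ℝ) * (rate (T i) * edgeTime τ (T i) (s i) - τ)) L (𝓝 s₀) := by
  have hinv : Tendsto (fun i => (T i ^ (1 / 3 : ℝ))⁻¹) L (𝓝 0) :=
    tendsto_inv_atTop_zero.comp (tendsto_scale hT)
  have h := ((tendsto_time_error τ hT hs).mul hinv).add hs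
  rw [zero_mul, zero_add] at h
  refine h.congr' ?_
  filter_upwards [hT.eventually_gt_atTop 1] with i hi
  have hn : T i ^ (1 / 3 : ℝ) ≠ 0 := by positivity
  field_simp
  ring

theorem edgeRegime (hτ : 0 < τ) (hT : Tendsto T L atTop) (hs : Tendsto s L (𝓝 s₀)) :
    EdgeRegime L (fun i => T i ^ (1 / 3 : ℝ)) (fun i => rate (T i))
      (fun i => rate (T i) * edgeTime τ (T i) (s i)) τ where
  pos := hτ
  tendsto_scale := tendsto_scale hT
  step_pos := (hT.eventually_gt_atTop 1).mono fun i hi => rate_pos hi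
  tendsto_step := by
    refine (tendsto_rate_mul hT).congr' ?_
    filter_upwards [hT.eventually_gt_atTop 1] with i hi
    rw [rpow_third_pow (by linarith)]
  tendsto_time := by
    have hinv : Tendsto (fun i => (T i ^ (1 / 3 : ℝ))⁻¹) L (𝓝 0) :=
      tendsto_inv_atTop_zero.comp (tendsto_scale hT)
    have h := ((tendsto_scaled_time τ hT hs).mul hinv).add_const τ
    rw [mul_zero, zero_add] at h
    refine h.congr' ?_
    filter_upwards [hT.eventually_gt_atTop 1] with i hi
    have hn : T i ^ (1 / 3 : ℝ) ≠ 0 := by positivity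
    field_simp
    ring

/-- The positions `j(r,s)` lie in the edge window of the wave functions at time `t(s)`. -/
theorem tendsto_edgePos (hτ : 0 < τ) (hT : Tendsto T L atTop) (hs : Tendsto s L (𝓝 s₀))
    (hr : Tendsto r L (𝓝 r₀)) :
    Tendsto (fun i => ((edgePos τ (T i) (r i) (s i) : ℝ) -
      edgeSlope (rate (T i)) (rate (T i) * edgeTime τ (T i) (s i))) / T i ^ (1 / 3 : ℝ))
      L (𝓝 r₀) := by
  have hreg := edgeRegime hτ hT hs
  have hN := tendsto_scale hT
  have hinv : Tendsto (fun i => (T i ^ (1 / 3 : ℝ))⁻¹) L (𝓝 0) := tendsto_inv_atTop_zero.comp hN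
  set u := fun i => rate (T i) * edgeTime τ (T i) (s i) with hu
  set b₁ := deriv border τ
  set b₂ := deriv (deriv border) τ with hb₂
  have hO : ∀ {f : ι → ℝ} {C : ℝ}, (∀ᶠ i in L, |f i| ≤ C) →
      Tendsto (fun i => f i * (T i ^ (1 / 3 : ℝ))⁻¹) L (𝓝 0) := by
    intro f C hf
    have h : Tendsto (fun i => C * (T i ^ (1 / 3 : ℝ))⁻¹) L (𝓝 0) := by
      simpa using hinv.const_mul C
    refine squeeze_zero_norm' ?_ h
    filter_upwards [hf, hT.eventually_gt_atTop 1] with i hi h1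
    have hn : 0 < T i ^ (1 / 3 : ℝ) := by positivity
    rw [norm_mul, Real.norm_eq_abs, Real.norm_of_nonneg (by positivity)]
    gcongr
  have hupos : ∀ᶠ i in L, τ / 2 < u i :=
    hreg.tendsto_time.eventually_const_lt (by linarith)
  -- Six errors separate the position from its prediction: c1 the integer part, c2 the slope against
  -- b_∞(u)/η, c3 the replacement of 1/η by T, c4 the Taylor remainder, and c5, c6 the use of s/N
  -- for u - τ in the linear and quadratic terms.
  have c1 : Tendsto (fun i => ((edgePos τ (T i) (r i) (s i) : ℝ) -
      (border τ * T i + b₁ * s i * T i ^ (2 / 3 : ℝ) + 1 / 2 * b₂ * s i ^ 2 * T i ^ (1 / 3 : ℝ) +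
        r i * T i ^ (1 / 3 : ℝ))) * (T i ^ (1 / 3 : ℝ))⁻¹) L (𝓝 0) := by
    refine hO (C := 1) (Eventually.of_forall fun i => ?_)
    unfold edgePos
    have h2 := Int.floor_le (border τ * T i + b₁ * s i * T i ^ (2 / 3 : ℝ) +
      1 / 2 * b₂ * s i ^ 2 * T i ^ (1 / 3 : ℝ) + r i * T i ^ (1 / 3 : ℝ))
    have h3 := Int.lt_floor_add_one (border τ * T i + b₁ * s i * T i ^ (2 / 3 : ℝ) +
      1 / 2 * b₂ * s i ^ 2 * T i ^ (1 / 3 : ℝ) + r i * T i ^ (1 / 3 : ℝ))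
    rw [abs_le]; constructor <;> linarith
  have c2 : Tendsto (fun i => (edgeSlope (rate (T i)) (u i) - border (u i) / rate (T i)) *
      (T i ^ (1 / 3 : ℝ))⁻¹) L (𝓝 0) := by
    refine hO (C := ∑' n : ℕ, Real.exp (-(((n : ℝ) + 1) * (τ / 2) / 2))) ?_
    have hsum : ∀ {v : ℝ}, 0 < v → Summable fun n : ℕ => Real.exp (-(((n : ℝ) + 1) * v / 2)) := by
      intro v hv
      have := (summable_nat_add_iff 1).2 (summable_exp_neg_mul (half_pos hv))
      refine this.congr fun n => ?_
      push_cast; congr 1; ring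
    filter_upwards [hupos, hT.eventually_gt_atTop 1] with i hi h1
    refine (abs_edgeSlope_sub_le (rate_pos h1) (by linarith)).trans
      ((hsum (by linarith)).tsum_le_tsum (fun n => ?_) (hsum (by linarith)))
    gcongr
  have c3 : Tendsto (fun i => (border (u i) * (1 / rate (T i) - T i)) *
      (T i ^ (1 / 3 : ℝ))⁻¹) L (𝓝 0) := by
    have hb : Tendsto (fun i => border (u i)) L (𝓝 (border τ)) :=
      ((hasDerivAt_border hτ).continuousAt.tendsto).comp hreg.tendsto_time
    refine hO (C := |border τ| + 1) ?_
    filter_upwards [hb.abs.eventually_lt_const (lt_add_one _), hT.eventually_gt_atTop 1]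
      with i hi h1
    have hp := rate_pos h1
    have h2 : |1 / rate (T i) - T i| ≤ 1 := by
      have h3 := one_le_mul_rate h1
      have h4 := mul_rate_le_one h1
      have h5 : 1 / rate (T i) ≤ T i := by rwa [div_le_iff₀ hp]
      have h6 : T i - 1 ≤ 1 / rate (T i) := by rwa [le_div_iff₀ hp]
      rw [abs_le]; constructor <;> linarith
    rw [abs_mul]
    calc _ ≤ (|border τ| + 1) * 1 := by gcongr
      _ = _ := mul_one _
  have c4 : Tendsto (fun i => (T i ^ (1 / 3 : ℝ)) ^ 2 *
      (border (u i) - border τ - b₁ * (u i - τ) - b₂ / 2 * (u i - τ) ^ 2)) L (𝓝 0) := by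
    have ht := isLittleO_taylor_two (f := border) (f' := deriv border) (x := τ) (f'' := b₂)
      ((lt_mem_nhds hτ).mono fun y hy => (hasDerivAt_border hy).differentiableAt.hasDerivAt)
      (hasDerivAt_deriv_border hτ).differentiableAt.hasDerivAt
    have ht2 := (ht.comp_tendsto hreg.tendsto_time)
    have h3 := (Asymptotics.isBigO_refl (fun i => (T i ^ (1 / 3 : ℝ)) ^ 2) L).mul_isLittleO ht2
    have h4 := ((tendsto_scaled_time τ hT hs).pow 2).isBigO_one ℝ
    have h5 : (fun i => (T i ^ (1 / 3 : ℝ)) ^ 2 *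
        (border (u i) - border τ - b₁ * (u i - τ) - b₂ / 2 * (u i - τ) ^ 2)) =o[L]
        fun _ => (1 : ℝ) := by
      refine h3.trans_isBigO (h4.congr_left fun i => ?_)
      simp only [Function.comp]
      ring
    simpa using h5.tendsto_div_nhds_zero
  have c5 := (tendsto_time_error τ hT hs).const_mul b₁
  have c6 := (((tendsto_scaled_time τ hT hs).pow 2).sub (hs.pow 2)).const_mul (b₂ / 2)
  have h := ((((c1.sub c2).sub c3).sub c4).sub c5).sub c6
  have h' := h.add hr
  simp only [sub_self, mul_zero, zero_add] at h'
  refine h'.congr' ?_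
  filter_upwards [hT.eventually_gt_atTop 1] with i hi
  have hn : T i ^ (1 / 3 : ℝ) ≠ 0 := by positivity
  rw [← rpow_third_sq (by linarith)]
  change _ = (_ - edgeSlope (rate (T i)) (u i)) / _
  have hui : rate (T i) * edgeTime τ (T i) (s i) = u i := rfl
  rw [hui]
  generalize hNN : T i ^ (1 / 3 : ℝ) = n at *
  have hT3 : T i = n ^ 3 := by rw [← hNN, rpow_third_pow (by linarith)]
  have hp := (rate_pos hi).ne'
  generalize edgeSlope (rate (T i)) (u i) = D
  generalize (edgePos τ (T i) (r i) (s i) : ℝ) = x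
  generalize rate (T i) = e at *
  rw [hT3]
  field_simp
  ring

end

/-! ### Riemann sums and continuous convergence -/

theorem tsum_eq_integral_floor {f : ℕ → ℂ} {a : ℝ} (ha : 0 < a)
    (hf : IntegrableOn (fun y : ℝ => f ⌊y * a⌋₊) (Ioi 0)) :
    (a : ℂ)⁻¹ * ∑' n, f n = ∫ y in Ioi (0 : ℝ), f ⌊y * a⌋₊ := by
  have hfl : ∀ n : ℕ, ∀ y : ℝ, y ∈ Ico (n / a) ((n + 1) / a) → ⌊y * a⌋₊ = n := by
    intro n y hy
    have h1 := (div_le_iff₀ ha).1 hy.1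
    have h2 := (lt_div_iff₀ ha).1 hy.2
    exact (Nat.floor_eq_iff ((Nat.cast_nonneg n).trans h1)).2 ⟨h1, h2⟩
  have hU : ⋃ n : ℕ, Ico ((n : ℝ) / a) ((n + 1) / a) = Ici 0 := by
    ext y
    simp only [mem_iUnion, mem_Ici]
    constructor
    · rintro ⟨n, hn⟩
      exact le_trans (by positivity) hn.1
    · intro hy
      refine ⟨⌊y * a⌋₊, ?_, ?_⟩
      · rw [div_le_iff₀ ha]; exact Nat.floor_le (by positivity)
      · rw [lt_div_iff₀ ha]; exact Nat.lt_floor_add_one _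
  have hdis : Pairwise (Function.onFun Disjoint fun n : ℕ => Ico ((n : ℝ) / a) ((n + 1) / a)) := by
    intro m n hmn
    refine Set.disjoint_left.2 fun y hm hn => hmn ?_
    rw [← hfl m y hm, hfl n y hn]
  have h := hasSum_integral_iUnion (μ := volume) (f := fun y : ℝ => f ⌊y * a⌋₊)
    (s := fun n : ℕ => Ico ((n : ℝ) / a) ((n + 1) / a)) (fun n => measurableSet_Ico) hdis
    (by rw [hU]; exact (integrableOn_Ici_iff_integrableOn_Ioi (by simp)).2 hf)
  rw [hU, integral_Ici_eq_integral_Ioi] at h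
  rw [← h.tsum_eq, ← tsum_mul_left]
  refine tsum_congr fun n => ?_
  rw [setIntegral_congr_fun measurableSet_Ico (g := fun _ => f n)
    (fun y hy => congrArg f (hfl n y hy)), setIntegral_const, measureReal_def, Real.volume_Ico,
    ENNReal.toReal_ofReal (by rw [← sub_div]; exact div_nonneg (by linarith) ha.le),
    ← sub_div, add_sub_cancel_left, Complex.real_smul]
  push_cast; ring

/-- Convergence of Riemann sums on a half-line with an exponential bound. -/
theorem tendsto_riemann_sum {ι : Type*} {L : Filter ι} [L.IsCountablyGenerated] {N : ι → ℝ}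
    (hN : Tendsto N L atTop) {F : ι → ℕ → ℂ} {G : ℝ → ℂ} {C c : ℝ} (hc : 0 < c)
    (hb : ∀ᶠ i in L, ∀ n : ℕ, ‖F i n‖ ≤ C * Real.exp (-(c * (n / N i))))
    (hp : ∀ y : ℝ, 0 < y → Tendsto (fun i => F i ⌊y * N i⌋₊) L (𝓝 (G y))) :
    Tendsto (fun i => (N i : ℂ)⁻¹ * ∑' n, F i n) L (𝓝 (∫ y in Ioi (0 : ℝ), G y)) := by
  have hmeas : ∀ i, AEStronglyMeasurable (fun y : ℝ => F i ⌊y * N i⌋₊)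
      (volume.restrict (Ioi 0)) := fun i =>
    (((measurable_from_top (f := F i)).comp Nat.measurable_floor).comp
      (measurable_id.mul_const (N i))).aestronglyMeasurable
  have hint : Integrable (fun y : ℝ => |C| * Real.exp c * Real.exp (-c * y))
      (volume.restrict (Ioi 0)) := (exp_neg_integrableOn_Ioi 0 hc).const_mul _
  have hbd : ∀ᶠ i in L, ∀ᵐ y ∂(volume.restrict (Ioi (0 : ℝ))),
      ‖F i ⌊y * N i⌋₊‖ ≤ |C| * Real.exp c * Real.exp (-c * y) := by
    filter_upwards [hb, hN.eventually_ge_atTop 1] with i hi h1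
    refine Eventually.of_forall fun y => (hi _).trans ?_
    have hn : 0 < N i := by linarith
    have h2 : y - 1 ≤ (⌊y * N i⌋₊ : ℝ) / N i := by
      rw [le_div_iff₀ hn]
      have := Nat.lt_floor_add_one (y * N i)
      nlinarith
    rw [mul_assoc, ← Real.exp_add]
    -- Rounding y down costs at most 1/N ≤ 1 in the exponent's argument, hence the factor e^c.
    have h3 : -(c * ((⌊y * N i⌋₊ : ℝ) / N i)) ≤ c + -c * y := by nlinarith
    exact mul_le_mul (le_abs_self C) (Real.exp_le_exp.2 h3) (Real.exp_pos _).le (abs_nonneg C)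
  have key := tendsto_integral_filter_of_dominated_convergence _
    (Eventually.of_forall hmeas) hbd hint
    ((ae_restrict_iff' measurableSet_Ioi).2 (Eventually.of_forall hp))
  refine key.congr' ?_
  filter_upwards [hbd, hN.eventually_gt_atTop 0] with i hi hn
  exact (tsum_eq_integral_floor hn (hint.mono' (hmeas i) hi)).symm

/-- Continuous convergence on a compact set is uniform. -/
theorem tendstoUniformlyOn_of_forall_tendsto {X : Type*} [TopologicalSpace X] {F : ℝ → X → ℂ}
    {f : X → ℂ} {K : Set X} (hK : IsCompact K)
    (h : ∀ x ∈ K, Tendsto (fun y : ℝ × X => F y.1 y.2) (atTop ×ˢ 𝓝[K] x) (𝓝 (f x))) :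
    TendstoUniformlyOn F f atTop K := by
  rw [← tendstoLocallyUniformlyOn_iff_tendstoUniformlyOn_of_compact hK,
    tendstoLocallyUniformlyOn_iff_forall_tendsto]
  intro x hx
  -- Continuity of f on K is not assumed: each nearby value of f is a limit of values of F lying in
  -- a closed ball about f x, so it lies there too.
  have hfx : Tendsto f (𝓝[K] x) (𝓝 (f x)) := by
    rw [Metric.nhds_basis_closedBall.tendsto_right_iff]
    intro ε hε
    obtain ⟨U, hU, V, hV, hUV⟩ := mem_prod_iff.1 (h x hx (Metric.closedBall_mem_nhds (f x) hε))
    filter_upwards [hV, self_mem_nhdsWithin] with y hy hyK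
    have hlim : Tendsto (fun T => F T y) atTop (𝓝 (f y)) :=
      (h y hyK).comp (tendsto_id.prodMk
        ((tendsto_const_pure (b := y)).mono_right (pure_le_nhdsWithin hyK)))
    refine Metric.isClosed_closedBall.mem_of_tendsto hlim ?_
    filter_upwards [hU] with T hT using hUV (mk_mem_prod hT hy)
  exact ((hfx.comp tendsto_snd).prodMk_nhds (h x hx)).mono_right (nhds_le_uniformity _)

/-! ### The edge kernel as a sum of products of wave functions -/

theorem conjExp_eq (τ T r s : ℝ) :
    conjExp τ T r s = edgePos τ T r s * (rate T * edgeTime τ T s) / 2 := by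
  rw [conjExp, rate]; ring

theorem edgeKernel_eq_of_le {τ T r s r' s' σ : ℝ} (hT : 1 < T)
    (hσ : |σ| < rate T * edgeTime τ T s / 2) (hσ' : |σ| < rate T * edgeTime τ T s' / 2)
    (h : edgeTime τ T s' ≤ edgeTime τ T s) :
    edgeKernel τ T r s r' s' = ((T ^ (1 / 3 : ℝ) : ℝ) : ℂ) *
      ∑' n : ℕ, ((Real.exp (-(n * (rate T * edgeTime τ T s - rate T * edgeTime τ T s') / 2)) : ℝ) : ℂ) *
          (wave (rate T) (rate T * edgeTime τ T s') σ (edgePos τ T r' s' + n) *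
            wave (rate T) (rate T * edgeTime τ T s) σ (edgePos τ T r s + n)) := by
  have hp := rate_pos hT
  have hpos : ∀ {t : ℤ}, |σ| < rate T * t / 2 → 0 ≤ t := by
    intro t ht
    by_contra! hneg
    have : (t : ℝ) < 0 := by exact_mod_cast hneg
    nlinarith [abs_nonneg σ]
  obtain ⟨t, ht⟩ := Int.eq_ofNat_of_zero_le (hpos hσ)
  obtain ⟨t', ht'⟩ := Int.eq_ofNat_of_zero_le (hpos hσ')
  rw [edgeKernel, green, if_pos h, conjExp_eq, conjExp_eq, ← exp_neg_rate hT]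
  rw [ht, Int.cast_natCast] at hσ
  rw [ht', Int.cast_natCast] at hσ'
  simp only [ht, ht', Int.cast_natCast]
  rw [creAnn_eq hp t t' hσ hσ', ← mul_assoc]
  congr 1
  rw [← Complex.ofReal_mul, mul_right_comm, ← Real.exp_add]
  congr 1
  -- The conjugation cancels the prefactor of the two-point function exactly.
  rw [show ∀ a b : ℝ, a - b + (b - a) = 0 by intros; ring, Real.exp_zero, one_mul]

theorem edgeKernel_eq_of_lt {τ T r s r' s' σ : ℝ} (hT : 1 < T)
    (hσ : |σ| < rate T * edgeTime τ T s / 2) (hσ' : |σ| < rate T * edgeTime τ T s' / 2)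
    (h : edgeTime τ T s < edgeTime τ T s') :
    edgeKernel τ T r s r' s' = -(((T ^ (1 / 3 : ℝ) : ℝ) : ℂ) *
      ∑' n : ℕ, ((Real.exp (-((n + 1) * (rate T * edgeTime τ T s' - rate T * edgeTime τ T s) / 2)) : ℝ) : ℂ) *
          (wave (rate T) (rate T * edgeTime τ T s') σ (edgePos τ T r' s' - (n + 1)) *
            wave (rate T) (rate T * edgeTime τ T s) σ (edgePos τ T r s - (n + 1)))) := by
  have hp := rate_pos hT
  have hpos : ∀ {t : ℤ}, |σ| < rate T * t / 2 → 0 ≤ t := by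
    intro t ht
    by_contra! hneg
    have : (t : ℝ) < 0 := by exact_mod_cast hneg
    nlinarith [abs_nonneg σ]
  obtain ⟨t, ht⟩ := Int.eq_ofNat_of_zero_le (hpos hσ)
  obtain ⟨t', ht'⟩ := Int.eq_ofNat_of_zero_le (hpos hσ')
  rw [edgeKernel, green, if_neg (not_le.2 h), conjExp_eq, conjExp_eq, ← exp_neg_rate hT]
  rw [ht, Int.cast_natCast] at hσ
  rw [ht', Int.cast_natCast] at hσ'
  simp only [ht, ht', Int.cast_natCast]
  rw [annCre_eq hp t t' hσ hσ', mul_neg, ← mul_assoc]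
  congr 2
  rw [← Complex.ofReal_mul, mul_right_comm, ← Real.exp_add]
  congr 1
  rw [show ∀ a b : ℝ, a - b + (b - a) = 0 by intros; ring, Real.exp_zero, one_mul]

/-! ### The limiting kernel -/

theorem inv_kappa_mul_airyKernel_of_le {τ : ℝ} (hτ : 0 < τ) {r s r' s' : ℝ} (h : s' ≤ s) :
    (kappa τ)⁻¹ * airyKernel (r / kappa τ) (kappa τ / 2 * s) (r' / kappa τ) (kappa τ / 2 * s') =
      ∫ y in Ioi (0 : ℝ), Real.exp (-(y * (s - s') / 2)) *
        (((kappa τ)⁻¹ * Ai ((r' + y) / kappa τ)) * ((kappa τ)⁻¹ * Ai ((r + y) / kappa τ))) := by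
  have hκ := kappa_pos hτ
  have h1 := integral_comp_neg_Ioi (0 : ℝ) (fun x : ℝ =>
    Real.exp (x * (kappa τ / 2 * s - kappa τ / 2 * s')) * Ai (r / kappa τ - x) *
      Ai (r' / kappa τ - x))
  have h2 := integral_comp_mul_left_Ioi (fun y : ℝ => Real.exp (-(y * (s - s') / 2)) *
        (((kappa τ)⁻¹ * Ai ((r' + y) / kappa τ)) * ((kappa τ)⁻¹ * Ai ((r + y) / kappa τ)))) 0 hκ
  rw [mul_zero, smul_eq_mul] at h2
  rw [neg_zero] at h1
  rw [airyKernel, if_pos (by gcongr), ← h1, ← mul_right_inj' (inv_ne_zero hκ.ne'), ← h2,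
    ← integral_const_mul, ← integral_const_mul]
  refine setIntegral_congr_fun measurableSet_Ioi fun x _ => ?_
  have e1 : -x * (kappa τ / 2 * s - kappa τ / 2 * s') = -(kappa τ * x * (s - s') / 2) := by ring
  have e2 : ∀ ρ : ℝ, ρ / kappa τ - -x = (ρ + kappa τ * x) / kappa τ := by
    intro ρ; field_simp; ring
  simp only [e1, e2]
  ring

theorem inv_kappa_mul_airyKernel_of_lt {τ : ℝ} (hτ : 0 < τ) {r s r' s' : ℝ} (h : s < s') :
    (kappa τ)⁻¹ * airyKernel (r / kappa τ) (kappa τ / 2 * s) (r' / kappa τ) (kappa τ / 2 * s') =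
      -∫ y in Ioi (0 : ℝ), Real.exp (-(y * (s' - s) / 2)) *
        (((kappa τ)⁻¹ * Ai ((r' - y) / kappa τ)) * ((kappa τ)⁻¹ * Ai ((r - y) / kappa τ))) := by
  have hκ := kappa_pos hτ
  have h2 := integral_comp_mul_left_Ioi (fun y : ℝ => Real.exp (-(y * (s' - s) / 2)) *
        (((kappa τ)⁻¹ * Ai ((r' - y) / kappa τ)) * ((kappa τ)⁻¹ * Ai ((r - y) / kappa τ)))) 0 hκ
  rw [mul_zero, smul_eq_mul] at h2
  rw [airyKernel, if_neg (not_le.2 (by gcongr)), mul_neg, neg_inj,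
    ← mul_right_inj' (inv_ne_zero hκ.ne'), ← h2, ← integral_const_mul, ← integral_const_mul]
  refine setIntegral_congr_fun measurableSet_Ioi fun x _ => ?_
  have e1 : x * (kappa τ / 2 * s - kappa τ / 2 * s') = -(kappa τ * x * (s' - s) / 2) := by ring
  have e2 : ∀ ρ : ℝ, ρ / kappa τ - x = (ρ - kappa τ * x) / kappa τ := by
    intro ρ; field_simp
  simp only [e1, e2]
  ring

/-! ### Convergence of the edge kernel along convergent parameters -/

section

variable {ι : Type*} {L : Filter ι} {T s r s' r' : ι → ℝ} {τ s₀ r₀ s₀' r₀' : ℝ}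

/-- The limit of a wave function along a sequence of lattice positions shifted by `m`, where
`m / N → y`. -/
theorem tendsto_wave_shift [L.IsCountablyGenerated] (hτ : 0 < τ) (hT : Tendsto T L atTop)
    (hs : Tendsto s L (𝓝 s₀)) (hr : Tendsto r L (𝓝 r₀)) {σ : ℝ} (hσ : 0 < σ) {m : ι → ℤ} {y : ℝ}
    (hm : Tendsto (fun i => (m i : ℝ) / T i ^ (1 / 3 : ℝ)) L (𝓝 y)) :
    Tendsto (fun i => ((T i ^ (1 / 3 : ℝ) : ℝ) : ℂ) * wave (rate (T i))
        (rate (T i) * edgeTime τ (T i) (s i)) (σ / T i ^ (1 / 3 : ℝ))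
        (edgePos τ (T i) (r i) (s i) + m i)) L
      (𝓝 (((kappa τ)⁻¹ * Ai ((r₀ + y) / kappa τ) : ℝ) : ℂ)) := by
  rw [← cubicLine_eq_Ai (kappa_pos hτ) hσ, kappa_pow hτ]
  refine (edgeRegime hτ hT hs).tendsto_wave hσ ?_
  refine ((tendsto_edgePos hτ hT hs hr).add hm).congr fun i => ?_
  push_cast; ring

/-- Bounds for the wave functions in the edge window. -/
theorem wave_shift_bound (hτ : 0 < τ) (hT : Tendsto T L atTop)
    (hs : Tendsto s L (𝓝 s₀)) (hr : Tendsto r L (𝓝 r₀)) {σ : ℝ} (hσ : 0 < σ) :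
    ∃ C : ℝ, 0 < C ∧ ∀ᶠ i in L, ∀ m : ℤ,
      ‖((T i ^ (1 / 3 : ℝ) : ℝ) : ℂ) * wave (rate (T i))
        (rate (T i) * edgeTime τ (T i) (s i)) (σ / T i ^ (1 / 3 : ℝ))
        (edgePos τ (T i) (r i) (s i) + m)‖ ≤ C * Real.exp (-(σ * (m / T i ^ (1 / 3 : ℝ)))) := by
  obtain ⟨C, hC, hb⟩ := (edgeRegime hτ hT hs).wave_bound hσ
  refine ⟨C * Real.exp (σ * (|r₀| + 1)), by positivity, ?_⟩
  filter_upwards [hb, (tendsto_edgePos hτ hT hs hr).abs.eventually_lt_const (lt_add_one _)]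
    with i hi hx m
  refine (hi _).trans ?_
  rw [mul_assoc, ← Real.exp_add]
  gcongr
  have h1 := neg_abs_le (((edgePos τ (T i) (r i) (s i) : ℝ) -
      edgeSlope (rate (T i)) (rate (T i) * edgeTime τ (T i) (s i))) / T i ^ (1 / 3 : ℝ))
  push_cast
  rw [add_sub_right_comm, add_div, mul_add]
  nlinarith

theorem eventually_abscissa (hτ : 0 < τ) (hT : Tendsto T L atTop) (hs : Tendsto s L (𝓝 s₀))
    {σ : ℝ} (hσ : 0 < σ) :
    ∀ᶠ i in L, |σ / T i ^ (1 / 3 : ℝ)| < rate (T i) * edgeTime τ (T i) (s i) / 2 := by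
  filter_upwards [((tendsto_scale hT).const_div_atTop σ).eventually_lt_const
      (show (0 : ℝ) < τ / 4 by linarith),
    (edgeRegime hτ hT hs).tendsto_time.eventually_const_lt (show τ / 2 < τ by linarith),
    hT.eventually_gt_atTop 0] with i h1 h2 h3
  rw [abs_of_pos (by positivity)]
  linarith

/-- The difference of the rescaled times, on the scale of the edge. -/
theorem tendsto_time_sub (τ : ℝ) (hT : Tendsto T L atTop) (hs : Tendsto s L (𝓝 s₀))
    (hs' : Tendsto s' L (𝓝 s₀')) :
    Tendsto (fun i => T i ^ (1 / 3 : ℝ) * (rate (T i) * edgeTime τ (T i) (s i) -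
      rate (T i) * edgeTime τ (T i) (s' i))) L (𝓝 (s₀ - s₀')) :=
  ((tendsto_scaled_time τ hT hs).sub (tendsto_scaled_time τ hT hs')).congr fun i => by ring

theorem tendsto_floor_div {N : ι → ℝ} (hN : Tendsto N L atTop) {y : ℝ} (hy : 0 < y) :
    Tendsto (fun i => (⌊y * N i⌋₊ : ℝ) / N i) L (𝓝 y) :=
  (tendsto_nat_floor_mul_div_atTop hy.le).comp hN

theorem edgeTime_mono (τ : ℝ) {T s s' : ℝ} (hT : 0 < T) (h : s' ≤ s) :
    edgeTime τ T s' ≤ edgeTime τ T s := by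
  unfold edgeTime; gcongr

/-- Here the time factor is at most 1 and both wave functions decay to the right, so the Riemann sum
is dominated even when the times coincide. With abscissa 1/N for each factor the product decays at
rate 2. -/
theorem tendsto_edgeKernel_of_le [L.IsCountablyGenerated] (hτ : 0 < τ) (hT : Tendsto T L atTop)
    (hs : Tendsto s L (𝓝 s₀)) (hr : Tendsto r L (𝓝 r₀)) (hs' : Tendsto s' L (𝓝 s₀'))
    (hr' : Tendsto r' L (𝓝 r₀')) (hle : ∀ᶠ i in L, s' i ≤ s i) (hle₀ : s₀' ≤ s₀) :
    Tendsto (fun i => edgeKernel τ (T i) (r i) (s i) (r' i) (s' i)) L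
      (𝓝 (((kappa τ)⁻¹ * airyKernel (r₀ / kappa τ) (kappa τ / 2 * s₀) (r₀' / kappa τ)
        (kappa τ / 2 * s₀') : ℝ) : ℂ)) := by
  obtain ⟨C, hC, hb⟩ := wave_shift_bound hτ hT hs hr one_pos
  obtain ⟨C', hC', hb'⟩ := wave_shift_bound hτ hT hs' hr' one_pos
  have hN := tendsto_scale hT
  rw [inv_kappa_mul_airyKernel_of_le hτ hle₀, ← integral_complex_ofReal]
  have key := tendsto_riemann_sum (F := fun i n =>
      ((Real.exp (-(n * (rate (T i) * edgeTime τ (T i) (s i) -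
        rate (T i) * edgeTime τ (T i) (s' i)) / 2)) : ℝ) : ℂ) *
      ((((T i ^ (1 / 3 : ℝ) : ℝ) : ℂ) * wave (rate (T i)) (rate (T i) * edgeTime τ (T i) (s' i))
        (1 / T i ^ (1 / 3 : ℝ)) (edgePos τ (T i) (r' i) (s' i) + (n : ℤ))) *
      (((T i ^ (1 / 3 : ℝ) : ℝ) : ℂ) * wave (rate (T i)) (rate (T i) * edgeTime τ (T i) (s i))
        (1 / T i ^ (1 / 3 : ℝ)) (edgePos τ (T i) (r i) (s i) + (n : ℤ)))))
    (G := fun y => ((Real.exp (-(y * (s₀ - s₀') / 2)) *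
        (((kappa τ)⁻¹ * Ai ((r₀' + y) / kappa τ)) * ((kappa τ)⁻¹ * Ai ((r₀ + y) / kappa τ))) : ℝ) : ℂ))
    (C := C' * C) hN two_pos ?_ ?_
  · refine key.congr' ?_
    filter_upwards [eventually_abscissa hτ hT hs one_pos, eventually_abscissa hτ hT hs' one_pos,
      hT.eventually_gt_atTop 1, hle] with i h1 h2 h3 h4
    rw [edgeKernel_eq_of_le h3 h1 h2 (edgeTime_mono τ (by linarith) h4), ← tsum_mul_left,
      ← tsum_mul_left]
    refine tsum_congr fun n => ?_
    have hn : ((T i ^ (1 / 3 : ℝ) : ℝ) : ℂ) ≠ 0 := by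
      have : 0 < T i ^ (1 / 3 : ℝ) := by positivity
      exact_mod_cast this.ne'
    field_simp
  · filter_upwards [hb, hb', hT.eventually_gt_atTop 1, hle] with i h1 h2 h3 h4 n
    have h5 : Real.exp (-(n * (rate (T i) * edgeTime τ (T i) (s i) -
        rate (T i) * edgeTime τ (T i) (s' i)) / 2)) ≤ 1 := by
      rw [Real.exp_le_one_iff]
      have hp := rate_pos h3
      have : (edgeTime τ (T i) (s' i) : ℝ) ≤ edgeTime τ (T i) (s i) := by
        exact_mod_cast edgeTime_mono τ (by linarith) h4
      have := mul_le_mul_of_nonneg_left this hp.le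
      have := mul_nonneg (Nat.cast_nonneg (α := ℝ) n) (sub_nonneg.2 this)
      linarith
    rw [norm_mul, Complex.norm_real, Real.norm_of_nonneg (Real.exp_pos _).le, norm_mul]
    calc _ ≤ 1 * ((C' * Real.exp (-(1 * (((n : ℤ) : ℝ) / T i ^ (1 / 3 : ℝ))))) *
          (C * Real.exp (-(1 * (((n : ℤ) : ℝ) / T i ^ (1 / 3 : ℝ)))))) := by
          gcongr
          · exact h2 n
          · exact h1 n
      _ = C' * C * (Real.exp (-(1 * (((n : ℤ) : ℝ) / T i ^ (1 / 3 : ℝ)))) *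
          Real.exp (-(1 * (((n : ℤ) : ℝ) / T i ^ (1 / 3 : ℝ))))) := by ring
      _ = _ := by
          rw [← Real.exp_add, Int.cast_natCast]; congr 2; ring
  · intro y hy
    have hf := tendsto_floor_div hN hy
    have w := tendsto_wave_shift hτ hT hs hr one_pos
      (m := fun i => ((⌊y * T i ^ (1 / 3 : ℝ)⌋₊ : ℕ) : ℤ)) (y := y) (by simpa using hf)
    have w' := tendsto_wave_shift hτ hT hs' hr' one_pos
      (m := fun i => ((⌊y * T i ^ (1 / 3 : ℝ)⌋₊ : ℕ) : ℤ)) (y := y) (by simpa using hf)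
    have e := (Complex.continuous_ofReal.tendsto _).comp ((Real.continuous_exp.tendsto _).comp
      (((hf.mul (tendsto_time_sub τ hT hs hs')).div_const 2).neg))
    have := e.mul (w'.mul w)
    rw [← Complex.ofReal_mul, ← Complex.ofReal_mul] at this
    refine this.congr' ?_
    filter_upwards [hT.eventually_gt_atTop 0] with i hi
    have hn : T i ^ (1 / 3 : ℝ) ≠ 0 := by positivity
    simp only [Function.comp]
    congr 4
    field_simp

/-- The sum runs to the left, where each wave bound grows like e^{σk}. The limiting gap of the times
supplies a decay that outweighs both once σ is small compared with it. -/
theorem tendsto_edgeKernel_of_lt [L.IsCountablyGenerated] (hτ : 0 < τ) (hT : Tendsto T L atTop)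
    (hs : Tendsto s L (𝓝 s₀)) (hr : Tendsto r L (𝓝 r₀)) (hs' : Tendsto s' L (𝓝 s₀'))
    (hr' : Tendsto r' L (𝓝 r₀')) (hlt : s₀ < s₀') :
    Tendsto (fun i => edgeKernel τ (T i) (r i) (s i) (r' i) (s' i)) L
      (𝓝 (((kappa τ)⁻¹ * airyKernel (r₀ / kappa τ) (kappa τ / 2 * s₀) (r₀' / kappa τ)
        (kappa τ / 2 * s₀') : ℝ) : ℂ)) := by
  -- Eventually the scaled time difference exceeds 8σ, half its limit. The time factor is then at
  -- most e^{-4σk}, the two wave functions contribute e^{2σk}, and the net rate is 2σ.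
  set σ := (s₀' - s₀) / 16 with hσdef
  have hσ : 0 < σ := by rw [hσdef]; linarith
  obtain ⟨C, hC, hb⟩ := wave_shift_bound hτ hT hs hr hσ
  obtain ⟨C', hC', hb'⟩ := wave_shift_bound hτ hT hs' hr' hσ
  have hN := tendsto_scale hT
  have hd := tendsto_time_sub τ hT hs' hs
  have hd8 : ∀ᶠ i in L, 8 * σ < T i ^ (1 / 3 : ℝ) * (rate (T i) * edgeTime τ (T i) (s' i) -
      rate (T i) * edgeTime τ (T i) (s i)) :=
    hd.eventually_const_lt (by rw [hσdef]; linarith)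
  rw [inv_kappa_mul_airyKernel_of_lt hτ hlt, Complex.ofReal_neg, ← integral_complex_ofReal]
  have key := tendsto_riemann_sum (F := fun i n =>
      ((Real.exp (-((n + 1) * (rate (T i) * edgeTime τ (T i) (s' i) -
        rate (T i) * edgeTime τ (T i) (s i)) / 2)) : ℝ) : ℂ) *
      ((((T i ^ (1 / 3 : ℝ) : ℝ) : ℂ) * wave (rate (T i)) (rate (T i) * edgeTime τ (T i) (s' i))
        (σ / T i ^ (1 / 3 : ℝ)) (edgePos τ (T i) (r' i) (s' i) + -((n : ℤ) + 1))) *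
      (((T i ^ (1 / 3 : ℝ) : ℝ) : ℂ) * wave (rate (T i)) (rate (T i) * edgeTime τ (T i) (s i))
        (σ / T i ^ (1 / 3 : ℝ)) (edgePos τ (T i) (r i) (s i) + -((n : ℤ) + 1)))))
    (G := fun y => ((Real.exp (-(y * (s₀' - s₀) / 2)) *
        (((kappa τ)⁻¹ * Ai ((r₀' - y) / kappa τ)) * ((kappa τ)⁻¹ * Ai ((r₀ - y) / kappa τ))) : ℝ) : ℂ))
    (C := C' * C) (c := 2 * σ) hN (by positivity) ?_ ?_
  · refine key.neg.congr' ?_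
    filter_upwards [eventually_abscissa hτ hT hs hσ, eventually_abscissa hτ hT hs' hσ,
      hT.eventually_gt_atTop 1, hd8] with i h1 h2 h3 h4
    have hp := rate_pos h3
    have hn0 : 0 < T i ^ (1 / 3 : ℝ) := by positivity
    have h5 : edgeTime τ (T i) (s i) < edgeTime τ (T i) (s' i) := by
      have h6 : 0 < T i ^ (1 / 3 : ℝ) * rate (T i) *
          ((edgeTime τ (T i) (s' i) : ℝ) - edgeTime τ (T i) (s i)) := by nlinarith
      have h7 := (pos_iff_pos_of_mul_pos h6).1 (by positivity)
      exact_mod_cast sub_pos.1 h7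
    rw [edgeKernel_eq_of_lt h3 h1 h2 h5, ← tsum_mul_left, ← tsum_mul_left]
    congr 1
    refine tsum_congr fun n => ?_
    have hn : ((T i ^ (1 / 3 : ℝ) : ℝ) : ℂ) ≠ 0 := by exact_mod_cast hn0.ne'
    rw [← sub_eq_add_neg, ← sub_eq_add_neg]
    field_simp
  · filter_upwards [hb, hb', hT.eventually_gt_atTop 1, hd8] with i h1 h2 h3 h4 n
    have hn0 : 0 < T i ^ (1 / 3 : ℝ) := by positivity
    set k := ((n : ℝ) + 1) / T i ^ (1 / 3 : ℝ) with hk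
    have hk0 : (n : ℝ) / T i ^ (1 / 3 : ℝ) ≤ k := by
      rw [hk]; gcongr; linarith
    have hkpos : 0 ≤ k := by positivity
    have h5 : -(((n : ℝ) + 1) * (rate (T i) * edgeTime τ (T i) (s' i) -
        rate (T i) * edgeTime τ (T i) (s i)) / 2) ≤ -(4 * σ * k) := by
      have e : ((n : ℝ) + 1) * (rate (T i) * edgeTime τ (T i) (s' i) -
        rate (T i) * edgeTime τ (T i) (s i)) / 2 = k * (T i ^ (1 / 3 : ℝ) *
          (rate (T i) * edgeTime τ (T i) (s' i) - rate (T i) * edgeTime τ (T i) (s i))) / 2 := by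
        rw [hk]; field_simp
      rw [e]
      nlinarith
    have hm : (((-((n : ℤ) + 1) : ℤ) : ℝ) / T i ^ (1 / 3 : ℝ)) = -k := by
      rw [hk]; push_cast; ring
    have h1n := h1 (-((n : ℤ) + 1))
    have h2n := h2 (-((n : ℤ) + 1))
    rw [hm] at h1n h2n
    rw [norm_mul, Complex.norm_real, Real.norm_of_nonneg (Real.exp_pos _).le, norm_mul]
    calc _ ≤ Real.exp (-(4 * σ * k)) * ((C' * Real.exp (-(σ * -k))) *
          (C * Real.exp (-(σ * -k)))) := by
          gcongr
      _ = C' * C * (Real.exp (-(4 * σ * k)) * (Real.exp (-(σ * -k)) * Real.exp (-(σ * -k)))) := by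
          ring
      _ ≤ _ := by
          rw [← Real.exp_add, ← Real.exp_add]
          gcongr
          nlinarith
  · intro y hy
    have hf : Tendsto (fun i => ((⌊y * T i ^ (1 / 3 : ℝ)⌋₊ : ℝ) + 1) / T i ^ (1 / 3 : ℝ)) L
        (𝓝 y) := by
      have := (tendsto_floor_div hN hy).add (tendsto_inv_atTop_zero.comp hN)
      rw [add_zero] at this
      refine this.congr fun i => ?_
      simp only [Function.comp]; ring
    have hf' : Tendsto (fun i => ((-(((⌊y * T i ^ (1 / 3 : ℝ)⌋₊ : ℕ) : ℤ) + 1) : ℤ) : ℝ) /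
        T i ^ (1 / 3 : ℝ)) L (𝓝 (-y)) := by
      refine hf.neg.congr fun i => ?_
      push_cast; ring
    have w := tendsto_wave_shift hτ hT hs hr hσ hf'
    have w' := tendsto_wave_shift hτ hT hs' hr' hσ hf'
    have e := (Complex.continuous_ofReal.tendsto _).comp ((Real.continuous_exp.tendsto _).comp
      (((hf.mul hd).div_const 2).neg))
    have := e.mul (w'.mul w)
    rw [← Complex.ofReal_mul, ← Complex.ofReal_mul] at this
    simp only [← sub_eq_add_neg r₀, ← sub_eq_add_neg r₀'] at this
    refine this.congr' ?_
    filter_upwards [hT.eventually_gt_atTop 0] with i hi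
    have hn : T i ^ (1 / 3 : ℝ) ≠ 0 := by positivity
    simp only [Function.comp]
    congr 4
    field_simp

end

/-- Uniform convergence on compact sets of parameters from convergence along convergent
parameters. -/
theorem tendstoUniformlyOn_edgeKernel {τ : ℝ} (hτ : 0 < τ) {K : Set (ℝ × ℝ × ℝ × ℝ)}
    (hK : IsCompact K) (hKs : (∀ p ∈ K, p.2.2.2 ≤ p.2.1) ∨ ∀ p ∈ K, p.2.1 < p.2.2.2) :
    TendstoUniformlyOn
      (fun (T : ℝ) (p : ℝ × ℝ × ℝ × ℝ) => edgeKernel τ T p.1 p.2.1 p.2.2.1 p.2.2.2)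
      (fun p : ℝ × ℝ × ℝ × ℝ => (((kappa τ)⁻¹ * airyKernel (p.1 / kappa τ) (kappa τ / 2 * p.2.1)
        (p.2.2.1 / kappa τ) (kappa τ / 2 * p.2.2.2) : ℝ) : ℂ)) atTop K := by
  refine tendstoUniformlyOn_of_forall_tendsto hK fun p hp => ?_
  have hid : Tendsto (fun y : ℝ × (ℝ × ℝ × ℝ × ℝ) => y.2) (atTop ×ˢ 𝓝[K] p) (𝓝 p) :=
    tendsto_snd.mono_right nhdsWithin_le_nhds
  have hr := (continuous_fst.tendsto p).comp hid
  have hs := ((continuous_fst.comp continuous_snd).tendsto p).comp hid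
  have hr' := ((continuous_fst.comp (continuous_snd.comp continuous_snd)).tendsto p).comp hid
  have hs' := ((continuous_snd.comp (continuous_snd.comp continuous_snd)).tendsto p).comp hid
  rcases hKs with h | h
  · have hev : ∀ᶠ y : ℝ × (ℝ × ℝ × ℝ × ℝ) in atTop ×ˢ 𝓝[K] p, y.2.2.2.2 ≤ y.2.2.1 :=
      (tendsto_snd.eventually (self_mem_nhdsWithin (s := K))).mono fun y hy => h _ hy
    exact tendsto_edgeKernel_of_le hτ tendsto_fst hs hr hs' hr' hev (h p hp)
  · exact tendsto_edgeKernel_of_lt hτ tendsto_fst hs hr hs' hr' (h p hp)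

end

end CrystalEdge

/-- Uniform convergence of the edge-scaled kernel to the Airy kernel on bounded sets of
`(r, s, r', s')` that, on the side `s < s'`, stay away from the singularity of the Airy kernel at
`s = s'`. Membership in the set is `s' ≤ s` or `s + δ ≤ s'`, with `δ > 0` arbitrary. -/
theorem proposition4p2 (τ₀ : ℝ) (hτ₀ : 0 < τ₀) (B : Set (ℝ × ℝ × ℝ × ℝ))
    (hB : Bornology.IsBounded B) (δ : ℝ) (hδ : 0 < δ) :
    TendstoUniformlyOn
      (fun (T : ℝ) (p : ℝ × ℝ × ℝ × ℝ) =>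
        CrystalEdge.edgeKernel τ₀ T p.1 p.2.1 p.2.2.1 p.2.2.2)
      (fun p : ℝ × ℝ × ℝ × ℝ =>
        (((CrystalEdge.kappa τ₀)⁻¹ *
          CrystalEdge.airyKernel
            (p.1 / CrystalEdge.kappa τ₀) (CrystalEdge.kappa τ₀ / 2 * p.2.1)
            (p.2.2.1 / CrystalEdge.kappa τ₀) (CrystalEdge.kappa τ₀ / 2 * p.2.2.2) : ℝ) : ℂ))
      atTop
      (B ∩ {p | p.2.2.2 ≤ p.2.1 ∨ p.2.1 + δ ≤ p.2.2.2}) := by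
  -- Both alternatives are closed conditions, so they cut compact sets out of the closure of B; on
  -- each of them the sign of s - s' is constant in the sense needed.
  have hc : IsCompact (closure B) := hB.isCompact_closure
  have h1 := CrystalEdge.tendstoUniformlyOn_edgeKernel hτ₀
    (hc.inter_right (isClosed_le (f := fun p : ℝ × ℝ × ℝ × ℝ => p.2.2.2) (g := fun p => p.2.1)
      (by fun_prop) (by fun_prop))) (Or.inl fun p hp => hp.2)
  have h2 := CrystalEdge.tendstoUniformlyOn_edgeKernel hτ₀
    (hc.inter_right (isClosed_le (f := fun p : ℝ × ℝ × ℝ × ℝ => p.2.1 + δ)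
      (g := fun p => p.2.2.2) (by fun_prop) (by fun_prop)))
    (Or.inr fun p hp => (lt_add_of_pos_right _ hδ).trans_le hp.2)
  intro V hV
  filter_upwards [h1 V hV, h2 V hV] with T a b p hp
  rcases hp.2 with h | h
  · exact a p ⟨subset_closure hp.1, h⟩
  · exact b p ⟨subset_closure hp.1, h⟩
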